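/- Let $q, b$ be positive integers with $q\ge 2$, $q\mid b$ and $b/q\ge 2$, and let $\mu_{q,b}$ be the Cantor measure, i.e. the unique Borel probability measure on $\mathbb R$ with $\mu_{q,b}=\frac1q\sum_{i=0}^{q-1}\mu_{q,b}\circ f_i^{-1}$, $f_i(x)=x/b+i/q$. A set $\Lambda\subset\mathbb R$ is an orthogonal set of $\mu_{q,b}$ if the functions $e^{-2\pi i\lambda x}$, $\lambda\in\Lambda$, are mutually orthogonal in $L^2(\mu_{q,b})$; it is a maximal orthogonal set if it is not properly contained in another orthogonal set, and a spectrum if these functions form an orthonormal basis of $L^2(\mu_{q,b})$. Let $\Sigma_q^*$ be the set of nonempty finite words over $\{0,\dots,q-1\}$; for $\delta\in\Sigma_q^*$ and $k\ge1$ let $\delta|_k$ be the word of the first $k$ letters of $\delta000\cdots$. A maximal tree mapping is a map $\tau:\Sigma_q^*\to\{-1,0,\dots,b-2\}$ such that (i) $\tau(0^n)=0$ for all $n\ge1$; (ii) $\tau(\delta_1\cdots\delta_n)\in\delta_n+q\mathbb Z$ for all $\delta_1\cdots\delta_n\in\Sigma_q^*$; (iii) for every $\delta\in\Sigma_q^*$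 there is $\delta'\in\Sigma_q^*$ with $\tau((\delta\delta')|_n)=0$ for all sufficiently large $n$. Put $$\Lambda(\tau)=\Big\{\sum_{n=1}^\infty\tau(\delta|_n)b^{n-1}:\ \delta\in\Sigma_q^*,\ \tau(\delta|_m)=0\text{ for all sufficiently large }m\Big\}.$$ For $\delta,\delta'\in\Sigma_q^*$ let $A=\{m\ge1:\tau(\delta(\delta'|_m))\ne0\}=\{n_1<n_2<\cdots\}$, $n_0=0$, $B=\{m\ge1:\tau(\delta(\delta'|_m))\notin q\mathbb Z\}\subset A$, and $$\mathcal D_{\tau,\delta}(\delta')=\#A+\sum_{j:\,n_j\in B}(n_j-n_{j-1}-1)\in\{0,1,\dots,\infty\},\qquad \mathcal D_\tau=\sup_{\delta\in\Sigma_q^*}\ \inf_{\delta'\in\Sigma_q^*}\mathcal D_{\tau,\delta}(\delta').$$ **Theorem.** Let $\tau$ be a maximal tree mapping with $\mathcal D_\tau<\infty$ and let $K$ be an integer coprime to $b$. Then $K\Lambda(\tau)=\{K\lambda:\lambda\in\Lambda(\tau)\}$ is a spectrum of $\mu_{q,b}$ if and only if it is a maximal orthogonal set of $\mu_{q,b}$.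 Moreover, if $K>0$ and $\kappa$ is a maximal tree mapping with $\Lambda(\kappa)=K\Lambda(\tau)$, then $$\mathcal D_\kappa\le(2\lfloor\log_bK\rfloor+4)(\mathcal D_\tau+1).$$ -/

import Mathlib

open MeasureTheory Filter

noncomputable section

namespace Cantor

/-! ### The Cantor measure -/

/-- The uniform probability measure on the digits `{0, …, q - 1}`. -/
def digitMeasure (q : ℕ) : Measure (Fin q) :=
  (q : ENNReal)⁻¹ • ∑ i : Fin q, Measure.dirac i

instance digitMeasure_isProbability (q : ℕ) [NeZero q] : IsProbabilityMeasure (digitMeasure q) :=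
  ⟨by
    simp only [digitMeasure, Measure.smul_apply, Measure.finsetSum_apply, measure_univ,
      Finset.sum_const, Finset.card_univ, Fintype.card_fin, nsmul_eq_mul, mul_one, smul_eq_mul]
    exact ENNReal.inv_mul_cancel (by exact_mod_cast NeZero.ne q) (ENNReal.natCast_ne_top q)⟩

/-- The coding map of the iterated function system `f_i(x) = x / b + i / q`:
the digits `ω 0, ω 1, …` go to `∑ n, (ω n / q) * b ^ (-n)`,
the limit of `f_{ω 0} ∘ f_{ω 1} ∘ ⋯`. -/
def codingMap (q b : ℕ) (ω : ℕ → Fin q) : ℝ :=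
  ∑' n : ℕ, ((ω n : ℕ) : ℝ) / q / (b : ℝ) ^ n

/-- The Cantor measure `μ_{q,b}`: the law of the random point `∑ n, (ω n / q) * b ^ (-n)` with
independent uniformly distributed digits `ω n`. For `b ≥ 2` it is the (unique) self-similar
probability measure of the system `f_i(x) = x / b + i / q`, see `cantorMeasure_selfSimilar`. -/
def cantorMeasure (q b : ℕ) [NeZero q] : Measure ℝ :=
  (Measure.infinitePi fun _ : ℕ => digitMeasure q).map (codingMap q b)

lemma codingMap_summable (q b : ℕ) (hb : 2 ≤ b) (ω : ℕ → Fin q) :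
    Summable fun n : ℕ => ((ω n : ℕ) : ℝ) / q / (b : ℝ) ^ n := by
  have hb' : (2 : ℝ) ≤ b := by exact_mod_cast hb
  have hg : Summable fun n : ℕ => ((b : ℝ)⁻¹) ^ n :=
    summable_geometric_of_lt_one (by positivity) (inv_lt_one_of_one_lt₀ (by linarith))
  refine Summable.of_nonneg_of_le (fun n => by positivity) (fun n => ?_) hg
  rw [inv_pow, div_eq_mul_inv]
  have : ((ω n : ℕ) : ℝ) / q ≤ 1 :=
    div_le_one_of_le₀ (by exact_mod_cast (ω n).2.le) (by positivity)
  have h2 : (0 : ℝ) ≤ ((b : ℝ) ^ n)⁻¹ := by positivity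
  nlinarith

lemma codingMap_measurable (q b : ℕ) : Measurable (codingMap q b) := by
  unfold codingMap
  refine Measurable.tsum fun n => ?_
  have : Measurable fun i : Fin q => ((i : ℕ) : ℝ) / q / (b : ℝ) ^ n := measurable_of_finite _
  exact this.comp (measurable_pi_apply n)

instance cantorMeasure_isProbability (q b : ℕ) [NeZero q] :
    IsProbabilityMeasure (cantorMeasure q b) :=
  Measure.isProbabilityMeasure_map (codingMap_measurable q b).aemeasurable

/-- Putting the digit `i` in front of a digit sequence. -/
def consDigit {q : ℕ} (i : Fin q) (ω : ℕ → Fin q) : ℕ → Fin q :=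
  fun n => Nat.casesOn n i ω

lemma consDigit_measurable {q : ℕ} (i : Fin q) : Measurable (consDigit i) := by
  refine measurable_pi_lambda _ fun n => ?_
  cases n with
  | zero => exact measurable_const
  | succ n => exact measurable_pi_apply n

lemma codingMap_consDigit (q b : ℕ) (hb : 2 ≤ b) (i : Fin q) (ω : ℕ → Fin q) :
    codingMap q b (consDigit i ω) = codingMap q b ω / b + ((i : ℕ) : ℝ) / q := by
  unfold codingMap
  rw [(codingMap_summable q b hb (consDigit i ω)).tsum_eq_zero_add, ← tsum_div_const, add_comm]
  congr 1
  · refine tsum_congr fun n => ?_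
    rw [pow_succ, ← div_div]
    rfl
  · simp [consDigit]

lemma infinitePi_digitMeasure (q : ℕ) [NeZero q] :
    (q : ENNReal)⁻¹ • ∑ i : Fin q,
        (Measure.infinitePi fun _ : ℕ => digitMeasure q).map (consDigit i)
      = Measure.infinitePi fun _ : ℕ => digitMeasure q := by
  classical
  refine Measure.eq_infinitePi _ fun s t ht => ?_
  set T : ℕ → Set (Fin q) := fun n => if n ∈ s then t n else Set.univ with hT
  obtain ⟨N, hN⟩ : ∃ N, s ⊆ Finset.range (N + 1) := by
    obtain ⟨N, hN⟩ := s.exists_nat_subset_range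
    exact ⟨N, hN.trans (Finset.range_subset_range.2 (by omega))⟩
  have hset : Set.pi (s : Set ℕ) t = Set.pi (Finset.range (N + 1) : Set ℕ) T := by
    ext ω
    simp only [Set.mem_pi, Finset.mem_coe, hT]
    constructor
    · intro h n _
      split_ifs with hn
      · exact h n hn
      · trivial
    · intro h n hn
      have := h n (hN hn)
      rwa [if_pos hn] at this
  have hprod : ∏ n ∈ s, digitMeasure q (t n)
      = ∏ n ∈ Finset.range (N + 1), digitMeasure q (T n) := by
    rw [← Finset.prod_subset hN (f := fun n => digitMeasure q (T n))]
    · exact Finset.prod_congr rfl fun n hn => by simp [hT, hn]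
    · intro n _ hn
      simp [hT, hn]
  have hTm : ∀ n, MeasurableSet (T n) := fun n => (Set.toFinite _).measurableSet
  have hm : MeasurableSet (Set.pi (Finset.range (N + 1) : Set ℕ) T) :=
    MeasurableSet.pi (Finset.countable_toSet _) fun n _ => hTm n
  have hpre : ∀ i : Fin q, (Measure.infinitePi fun _ : ℕ => digitMeasure q).map (consDigit i)
      (Set.pi (Finset.range (N + 1) : Set ℕ) T)
      = (Measure.dirac i (T 0)) * ∏ n ∈ Finset.range N, digitMeasure q (T (n + 1)) := by
    intro i
    rw [Measure.map_apply (consDigit_measurable i) hm, Measure.dirac_apply' _ (hTm 0)]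
    by_cases hi : i ∈ T 0
    · have : consDigit i ⁻¹' (Set.pi (Finset.range (N + 1) : Set ℕ) T)
          = Set.pi (Finset.range N : Set ℕ) fun n => T (n + 1) := by
        ext ω
        simp only [Set.mem_preimage, Set.mem_pi, Finset.mem_coe, Finset.mem_range]
        constructor
        · intro h n hn
          exact h (n + 1) (by omega)
        · rintro h (_ | n) hn
          · exact hi
          · exact h n (by omega)
      rw [this, Measure.infinitePi_pi _ fun n _ => hTm (n + 1)]
      simp [hi]
    · have : consDigit i ⁻¹' (Set.pi (Finset.range (N + 1) : Set ℕ) T) = ∅ := by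
        ext ω
        simp only [Set.mem_preimage, Set.mem_pi, Finset.mem_coe, Finset.mem_range,
          Set.mem_empty_iff_false, iff_false]
        intro h
        exact hi (h 0 (by omega))
      rw [this]
      simp [hi]
  rw [hset, hprod, Finset.prod_range_succ', Measure.smul_apply, Measure.finsetSum_apply,
    Finset.sum_congr rfl fun i _ => hpre i, ← Finset.sum_mul, smul_eq_mul, ← mul_assoc, mul_comm]
  congr 1
  simp [digitMeasure]

/-- Self-similarity: `μ_{q,b} = (1 / q) ∑ i, μ_{q,b} ∘ f_i⁻¹` with `f_i(x) = x / b + i / q`. -/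
theorem cantorMeasure_selfSimilar (q b : ℕ) [NeZero q] (hb : 2 ≤ b) :
    cantorMeasure q b = (q : ENNReal)⁻¹ • ∑ i : Fin q,
      (cantorMeasure q b).map (fun x : ℝ => x / b + ((i : ℕ) : ℝ) / q) := by
  have hX := codingMap_measurable q b
  ext s hs
  conv_lhs => rw [cantorMeasure, ← infinitePi_digitMeasure q]
  rw [Measure.map_apply hX hs]
  simp only [Measure.smul_apply, Measure.finsetSum_apply]
  congr 1
  refine Finset.sum_congr rfl fun i _ => ?_
  have hf : Measurable (fun x : ℝ => x / b + ((i : ℕ) : ℝ) / q) := by fun_prop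
  rw [Measure.map_apply hf hs, cantorMeasure, Measure.map_apply hX (hf hs),
    Measure.map_apply (consDigit_measurable i) (hX hs)]
  congr 1
  ext ω
  simp only [Set.mem_preimage, codingMap_consDigit q b hb]

/-! ### Orthogonal sets and spectra -/

/-- The exponential `x ↦ exp (-2 π i λ x)`. -/
def expFun (l : ℝ) (x : ℝ) : ℂ :=
  Complex.exp (-(2 * Real.pi * l * x : ℝ) * Complex.I)

lemma expFun_memLp (μ : Measure ℝ) [IsFiniteMeasure μ] (l : ℝ) : MemLp (expFun l) 2 μ := by
  refine MemLp.of_bound (C := 1) ?_ (ae_of_all _ fun x => ?_)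
  · have : Continuous (expFun l) := by unfold expFun; fun_prop
    exact this.aestronglyMeasurable
  · rw [expFun, ← Complex.ofReal_neg, Complex.norm_exp_ofReal_mul_I]

/-- The exponential `x ↦ exp (-2 π i λ x)` as an element of `L²(μ)`. -/
def expLp (μ : Measure ℝ) [IsFiniteMeasure μ] (l : ℝ) : Lp ℂ 2 μ :=
  (expFun_memLp μ l).toLp (expFun l)

/-- `Λ` is an orthogonal set of `μ`: the exponentials `exp (-2 π i λ x)`, `λ ∈ Λ`, are mutually
orthogonal in `L²(μ)`. -/
def IsOrthogonalSet (μ : Measure ℝ) [IsFiniteMeasure μ] (Λ : Set ℝ) : Prop :=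
  ∀ l ∈ Λ, ∀ l' ∈ Λ, l ≠ l' → inner ℂ (expLp μ l) (expLp μ l') = 0

/-- `Λ` is a maximal orthogonal set of `μ`: an orthogonal set that is not properly contained in
another orthogonal set. -/
def IsMaximalOrthogonalSet (μ : Measure ℝ) [IsFiniteMeasure μ] (Λ : Set ℝ) : Prop :=
  IsOrthogonalSet μ Λ ∧ ∀ Λ' : Set ℝ, IsOrthogonalSet μ Λ' → Λ ⊆ Λ' → Λ' = Λ

/-- `Λ` is a spectrum of `μ`: the exponentials `exp (-2 π i λ x)`, `λ ∈ Λ`, form an orthonormal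
basis of `L²(μ)`. -/
def IsSpectrum (μ : Measure ℝ) [IsFiniteMeasure μ] (Λ : Set ℝ) : Prop :=
  ∃ B : HilbertBasis Λ ℂ (Lp ℂ 2 μ), ∀ l : Λ, B l = expLp μ (l : ℝ)

/-! ### Tree mappings

The tree branches (nonempty finite words over `{0, …, q - 1}`) are the nonempty lists over `Fin q`.
The value of a tree mapping at the empty list plays no role. -/

/-- `δ|_k`: the first `k` letters of `δ 0 0 0 ⋯`. -/
def trunc {q : ℕ} [NeZero q] (δ : List (Fin q)) (k : ℕ) : List (Fin q) :=
  (δ ++ List.replicate k 0).take k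

/-- Tree mappings `τ` from nonempty finite words over `{0, …, q - 1}` to `{-1, 0, …, b - 2}`. -/
structure IsTreeMapping (q b : ℕ) [NeZero q] (τ : List (Fin q) → ℤ) : Prop where
  range : ∀ δ, δ ≠ [] → -1 ≤ τ δ ∧ τ δ ≤ (b : ℤ) - 2
  zero : ∀ n : ℕ, 1 ≤ n → τ (List.replicate n 0) = 0
  last : ∀ (δ : List (Fin q)) (h : δ ≠ []), τ δ ≡ ((δ.getLast h : ℕ) : ℤ) [ZMOD (q : ℤ)]

/-- `δ` is a `τ`-regular branch: `τ(δ|_m) = 0` for all sufficiently large `m`. -/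
def IsRegular {q : ℕ} [NeZero q] (τ : List (Fin q) → ℤ) (δ : List (Fin q)) : Prop :=
  ∀ᶠ m : ℕ in atTop, τ (trunc δ m) = 0

/-- Maximal tree mappings. -/
structure IsMaximalTreeMapping (q b : ℕ) [NeZero q] (τ : List (Fin q) → ℤ) : Prop
    extends IsTreeMapping q b τ where
  maximal : ∀ δ : List (Fin q), δ ≠ [] → ∃ δ' : List (Fin q), δ' ≠ [] ∧ IsRegular τ (δ ++ δ')

/-- `Λ(τ) = {∑_{n ≥ 1} τ(δ|_n) b^(n-1) : δ a τ-regular branch}`. -/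
def treeSet {q : ℕ} [NeZero q] (b : ℕ) (τ : List (Fin q) → ℤ) : Set ℝ :=
  {x | ∃ δ : List (Fin q), δ ≠ [] ∧ IsRegular τ δ ∧
    x = ∑' n : ℕ, (τ (trunc δ (n + 1)) : ℝ) * (b : ℝ) ^ n}

/-- `A_δ(δ') = {m ≥ 1 : τ(δ(δ'|_m)) ≠ 0}`, the set `{n_1 < n_2 < ⋯}`. -/
def levelSet {q : ℕ} [NeZero q] (τ : List (Fin q) → ℤ) (δ δ' : List (Fin q)) : Set ℕ :=
  {m | 1 ≤ m ∧ τ (δ ++ trunc δ' m) ≠ 0}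

/-- For `m = n_j` in `A_δ(δ')` this is `n_{j-1}`: the largest element of `A_δ(δ')` below `m`,
and `n_0 = 0` if there is none. -/
def prevLevel {q : ℕ} [NeZero q] (τ : List (Fin q) → ℤ) (δ δ' : List (Fin q)) (m : ℕ) : ℕ :=
  sSup {k | k < m ∧ (k = 0 ∨ k ∈ levelSet τ δ δ')}

open Classical in
/-- `D_{τ,δ}(δ') = #A_δ(δ') + ∑_{n_j ∈ B_δ(δ')} (n_j - n_{j-1} - 1)`, where
`B_δ(δ') = {m ≥ 1 : τ(δ(δ'|_m)) ∉ qℤ} ⊆ A_δ(δ')`; it is `∞` if `A_δ(δ')` is infinite. -/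
def branchDist {q : ℕ} [NeZero q] (τ : List (Fin q) → ℤ) (δ δ' : List (Fin q)) : ℕ∞ :=
  if h : (levelSet τ δ δ').Finite then
    ((h.toFinset.card +
      ∑ m ∈ h.toFinset with ¬ (q : ℤ) ∣ τ (δ ++ trunc δ' m),
        (m - prevLevel τ δ δ' m - 1) : ℕ) : ℕ∞)
  else ⊤

/-- `D_{τ,δ} = inf {D_{τ,δ}(δ') : δ' a tree branch}`. -/
def minDist {q : ℕ} [NeZero q] (τ : List (Fin q) → ℤ) (δ : List (Fin q)) : ℕ∞ :=
  ⨅ (δ' : List (Fin q)) (_ : δ' ≠ []), branchDist τ δ δ'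

/-- `D_τ = sup {D_{τ,δ} : δ a tree branch}`. -/
def treeDist {q : ℕ} [NeZero q] (τ : List (Fin q) → ℤ) : ℕ∞ :=
  ⨆ (δ : List (Fin q)) (_ : δ ≠ []), minDist τ δ

/-- The rescaled set `KΛ`. -/
def rescale (K : ℤ) (Λ : Set ℝ) : Set ℝ := (fun x : ℝ => (K : ℝ) * x) '' Λ

end Cantor

end

noncomputable section

namespace Cantor

/-! ### Expansions of integers with the digits `-1, 0, …, b - 2` -/

/-- The last digit of `x` in base `b` with the digits `-1, 0, …, b - 2`. -/
def digit (b : ℕ) (x : ℤ) : ℤ := (x + 1) % b - 1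

/-- The integer obtained from `x` by deleting its last digit. -/
def shift (b : ℕ) (x : ℤ) : ℤ := (x + 1) / b

lemma digit_add_mul_shift (b : ℕ) (x : ℤ) : digit b x + b * shift b x = x := by
  have := Int.emod_add_mul_ediv (x + 1) b
  unfold digit shift
  linarith

lemma neg_one_le_digit {b : ℕ} (hb : b ≠ 0) (x : ℤ) : -1 ≤ digit b x := by
  have := Int.emod_nonneg (x + 1) (b := b) (by exact_mod_cast hb)
  unfold digit
  linarith

lemma digit_le {b : ℕ} (hb : b ≠ 0) (x : ℤ) : digit b x ≤ (b : ℤ) - 2 := by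
  have := Int.emod_lt_of_pos (x + 1) (b := b) (by exact_mod_cast Nat.pos_of_ne_zero hb)
  unfold digit
  linarith

lemma abs_digit_le {b : ℕ} (hb : 3 ≤ b) (x : ℤ) : |digit b x| ≤ (b : ℤ) - 2 := by
  have h1 := neg_one_le_digit (b := b) (by omega) x
  have h2 := digit_le (b := b) (by omega) x
  rw [abs_le]
  constructor <;> omega

lemma shift_add_mul {b : ℕ} (hb : b ≠ 0) (x w : ℤ) : shift b (x + b * w) = shift b x + w := by
  unfold shift
  rw [show x + b * w + 1 = x + 1 + b * w by ring, Int.add_mul_ediv_left _ _ (by exact_mod_cast hb)]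

lemma shift_eq_zero {b : ℕ} {x : ℤ} (h1 : -1 ≤ x) (h2 : x ≤ (b : ℤ) - 2) : shift b x = 0 :=
  Int.ediv_eq_zero_of_lt (by linarith) (by linarith)

lemma digit_eq_self {b : ℕ} {x : ℤ} (h1 : -1 ≤ x) (h2 : x ≤ (b : ℤ) - 2) : digit b x = x := by
  have := digit_add_mul_shift b x
  rw [shift_eq_zero h1 h2] at this
  linarith

lemma digit_add_mul {b : ℕ} (hb : b ≠ 0) (x w : ℤ) : digit b (x + b * w) = digit b x := by
  have h1 := digit_add_mul_shift b (x + b * w)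
  have h2 := digit_add_mul_shift b x
  rw [shift_add_mul hb] at h1
  linarith

lemma shift_mul {b : ℕ} (hb : 2 ≤ b) (w : ℤ) : shift b (b * w) = w := by
  have := shift_add_mul (b := b) (by omega) 0 w
  rwa [zero_add, shift_eq_zero (x := 0) (by norm_num) (by omega), zero_add] at this

lemma shift_zero {b : ℕ} (hb : 2 ≤ b) : shift b 0 = 0 :=
  shift_eq_zero (by norm_num) (by omega)

lemma digit_modEq (b : ℕ) (x : ℤ) : digit b x ≡ x [ZMOD b] :=
  (Int.modEq_iff_dvd).2 ⟨shift b x, by linarith [digit_add_mul_shift b x]⟩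

lemma digit_eq_zero_iff {b : ℕ} (hb : 3 ≤ b) (x : ℤ) : digit b x = 0 ↔ (b : ℤ) ∣ x := by
  constructor
  · intro h
    exact ⟨shift b x, by linarith [digit_add_mul_shift b x]⟩
  · rintro ⟨w, rfl⟩
    have := digit_add_mul (b := b) (by omega) 0 w
    rwa [zero_add, digit_eq_self (x := 0) (by norm_num) (by omega)] at this

lemma dvd_digit_iff {q b : ℕ} (hqb : q ∣ b) (x : ℤ) : (q : ℤ) ∣ digit b x ↔ (q : ℤ) ∣ x :=
  ((digit_modEq b x).of_dvd (Int.natCast_dvd_natCast.2 hqb)).dvd_iff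

lemma mul_abs_shift_le {b : ℕ} (hb : 3 ≤ b) (x : ℤ) :
    (b : ℤ) * |shift b x| ≤ |x| + (b - 2) := by
  have h1 := digit_add_mul_shift b x
  have h2 := abs_digit_le hb x
  calc (b : ℤ) * |shift b x| = |b * shift b x| := by rw [abs_mul, Nat.abs_cast]
    _ = |x - digit b x| := by rw [← h1]; congr 1; rw [h1]; linarith
    _ ≤ |x| + |digit b x| := abs_sub _ _
    _ ≤ _ := by linarith

lemma natAbs_shift_lt {b : ℕ} (hb : 3 ≤ b) {x : ℤ} (hx : x ≠ 0) :
    (shift b x).natAbs < x.natAbs := by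
  have h := mul_abs_shift_le hb x
  have hb' : (3 : ℤ) ≤ b := by exact_mod_cast hb
  zify
  by_contra! hc
  have hx1 : 1 ≤ |x| := Int.one_le_abs hx
  by_cases h1 : |x| = 1
  · have : x = 1 ∨ x = -1 := by
      rcases abs_eq (a := x) (b := 1) (by norm_num) |>.1 h1 with h | h <;> simp [h]
    have h0 : shift b x = 0 := by
      rcases this with rfl | rfl <;> exact shift_eq_zero (by omega) (by omega)
    rw [h0, h1] at hc
    norm_num at hc
  · have : 2 ≤ |x| := by omega
    nlinarith

lemma iterate_shift_zero {b : ℕ} (hb : 2 ≤ b) (n : ℕ) : (shift b)^[n] 0 = 0 :=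
  Function.iterate_fixed (shift_zero hb) n

lemma iterate_shift_eq_zero {b : ℕ} (hb : 3 ≤ b) (s : ℕ) {c : ℤ} (hc : |c| ≤ (b : ℤ) ^ s) :
    (shift b)^[s + 1] c = 0 := by
  induction s generalizing c with
  | zero =>
    rw [pow_zero, abs_le] at hc
    exact shift_eq_zero hc.1 (by omega)
  | succ s ih =>
    rw [Function.iterate_succ_apply]
    refine ih ?_
    have h := mul_abs_shift_le hb c
    have hb' : (3 : ℤ) ≤ b := by exact_mod_cast hb
    rw [pow_succ] at hc
    by_contra! hlt
    nlinarith

lemma exists_iterate_shift_eq_zero {b : ℕ} (hb : 3 ≤ b) (x : ℤ) :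
    ∃ N, ∀ n, N ≤ n → (shift b)^[n] x = 0 := by
  obtain ⟨s, hs⟩ : ∃ s : ℕ, |x| ≤ (b : ℤ) ^ s := by
    obtain ⟨s, hs⟩ := pow_unbounded_of_one_lt |x| (by exact_mod_cast (by omega : 1 < b) : (1 : ℤ) < b)
    exact ⟨s, hs.le⟩
  refine ⟨s + 1, fun n hn => ?_⟩
  obtain ⟨k, rfl⟩ := Nat.exists_eq_add_of_le' hn
  rw [Function.iterate_add_apply, iterate_shift_eq_zero hb s hs, iterate_shift_zero (by omega)]

/-- The integer formed by the last `n` digits of `x`. -/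
def lowPart (b n : ℕ) (x : ℤ) : ℤ := x - (b : ℤ) ^ n * (shift b)^[n] x

lemma lowPart_add (b n : ℕ) (x : ℤ) : lowPart b n x + (b : ℤ) ^ n * (shift b)^[n] x = x := by
  unfold lowPart
  ring

lemma lowPart_succ (b n : ℕ) (x : ℤ) :
    lowPart b (n + 1) x = lowPart b n x + (b : ℤ) ^ n * digit b ((shift b)^[n] x) := by
  unfold lowPart
  have := digit_add_mul_shift b ((shift b)^[n] x)
  rw [Function.iterate_succ_apply', pow_succ]
  linear_combination (-(b : ℤ) ^ n) * this

lemma abs_lowPart_le {b : ℕ} (hb : 3 ≤ b) (n : ℕ) (x : ℤ) :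
    ((b : ℤ) - 1) * |lowPart b n x| ≤ (b - 2) * (b : ℤ) ^ n := by
  have hb' : (3 : ℤ) ≤ b := by exact_mod_cast hb
  induction n with
  | zero => simp [lowPart]; linarith
  | succ n ih =>
    have hp : 0 < (b : ℤ) ^ n := by positivity
    have h1 : |lowPart b (n + 1) x| ≤ |lowPart b n x| + (b : ℤ) ^ n * (b - 2) := by
      rw [lowPart_succ]
      refine (abs_add_le _ _).trans ?_
      rw [abs_mul, abs_of_pos hp]
      have := abs_digit_le hb ((shift b)^[n] x)
      nlinarith
    rw [pow_succ]
    nlinarith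

lemma iterate_shift_add_mul {b : ℕ} (hb : b ≠ 0) (n : ℕ) (x w : ℤ) :
    (shift b)^[n] (x + (b : ℤ) ^ n * w) = (shift b)^[n] x + w := by
  induction n generalizing x with
  | zero => simp
  | succ n ih =>
    rw [Function.iterate_succ_apply, Function.iterate_succ_apply,
      show x + (b : ℤ) ^ (n + 1) * w = x + b * ((b : ℤ) ^ n * w) by ring, shift_add_mul hb, ih]

lemma lowPart_eq_of_dvd {b : ℕ} (hb : b ≠ 0) {n : ℕ} {x y : ℤ} (h : (b : ℤ) ^ n ∣ y - x) :
    lowPart b n y = lowPart b n x := by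
  obtain ⟨w, hw⟩ := h
  obtain rfl : y = x + (b : ℤ) ^ n * w := by linarith
  unfold lowPart
  rw [iterate_shift_add_mul hb]
  ring

lemma digit_iterate_eq_of_dvd {b : ℕ} (hb : b ≠ 0) {n k : ℕ} (hk : k < n) {x y : ℤ}
    (h : (b : ℤ) ^ n ∣ y - x) : digit b ((shift b)^[k] y) = digit b ((shift b)^[k] x) := by
  have hp : (b : ℤ) ^ k ≠ 0 := pow_ne_zero _ (by exact_mod_cast hb)
  have h1 := lowPart_succ b k y
  have h2 := lowPart_succ b k x
  rw [lowPart_eq_of_dvd hb ((pow_dvd_pow _ (by omega)).trans h),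
    lowPart_eq_of_dvd hb ((pow_dvd_pow _ hk.le).trans h), h2] at h1
  exact (mul_left_cancel₀ hp (by linarith)).symm

lemma dvd_sub_of_digit_eq {b : ℕ} {n : ℕ} {x y : ℤ}
    (h : ∀ k < n, digit b ((shift b)^[k] y) = digit b ((shift b)^[k] x)) :
    (b : ℤ) ^ n ∣ y - x := by
  have : lowPart b n y = lowPart b n x := by
    induction n with
    | zero => simp [lowPart]
    | succ n ih =>
      rw [lowPart_succ, lowPart_succ, ih fun k hk => h k (by omega), h n (by omega)]
  refine ⟨(shift b)^[n] y - (shift b)^[n] x, ?_⟩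
  have h1 := lowPart_add b n y
  have h2 := lowPart_add b n x
  rw [this] at h1
  linear_combination h2 - h1

/-! ### The cost of an integer -/

/-- The integers `b ^ k * u` with `q ∤ u`; these are zeros of the Fourier transform of the Cantor
measure. -/
def InZeroSet (q b : ℕ) (z : ℤ) : Prop := ∃ (k : ℕ) (u : ℤ), z = (b : ℤ) ^ k * u ∧ ¬ (q : ℤ) ∣ u

/-- The last digit of `z` is nonzero, or it is zero and the last nonzero digit is not divisible
by `q`. -/
def Charged (q b : ℕ) (z : ℤ) : Prop := ¬ (b : ℤ) ∣ z ∨ InZeroSet q b z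

/-- The number of digit positions of `y` which are nonzero, or which belong to a run of zeros
followed by a digit not divisible by `q`. -/
def cost (q b : ℕ) (y : ℤ) : ℕ∞ := Set.encard {m : ℕ | Charged q b ((shift b)^[m] y)}

/-- The number of nonzero digits of `y`. -/
def digitCount (b : ℕ) (y : ℤ) : ℕ∞ := Set.encard {m : ℕ | ¬ (b : ℤ) ∣ (shift b)^[m] y}

open Classical in
lemma encard_setOf_nat (p : ℕ → Prop) :
    Set.encard {m | p m} = (if p 0 then 1 else 0) + Set.encard {m | p (m + 1)} := by
  have h : {m | p m} = {m | m = 0 ∧ p 0} ∪ Nat.succ '' {m | p (m + 1)} := by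
    ext m
    cases m <;> simp
  rw [h, Set.encard_union_eq, Function.Injective.encard_image Nat.succ_injective]
  · congr 1
    split_ifs with h0 <;> simp [h0]
  · rw [Set.disjoint_left]
    rintro _ ⟨rfl, _⟩ ⟨m, _, hm⟩
    simp at hm

open Classical in
lemma cost_eq (q b : ℕ) (y : ℤ) :
    cost q b y = (if Charged q b y then 1 else 0) + cost q b (shift b y) := by
  unfold cost
  rw [encard_setOf_nat]
  rfl

lemma cost_le_one_add (q b : ℕ) (y : ℤ) : cost q b y ≤ 1 + cost q b (shift b y) := by
  classical
  rw [cost_eq]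
  gcongr
  split_ifs <;> simp

lemma cost_shift_le (q b : ℕ) (y : ℤ) : cost q b (shift b y) ≤ cost q b y := by
  classical
  rw [cost_eq q b y]
  exact le_add_self

open Classical in
lemma digitCount_eq (b : ℕ) (y : ℤ) :
    digitCount b y = (if (b : ℤ) ∣ y then 0 else 1) + digitCount b (shift b y) := by
  unfold digitCount
  rw [encard_setOf_nat]
  congr 1
  by_cases h : (b : ℤ) ∣ y <;> simp [h]

lemma digitCount_le_cost (q b : ℕ) (y : ℤ) : digitCount b y ≤ cost q b y :=
  Set.encard_le_encard fun _ hm => Or.inl hm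

lemma not_charged_zero {q b : ℕ} (hb : b ≠ 0) : ¬ Charged q b 0 := by
  rintro (h | ⟨k, u, h, hu⟩)
  · simp at h
  · have : u = 0 := by
      have hp : (b : ℤ) ^ k ≠ 0 := pow_ne_zero _ (by exact_mod_cast hb)
      simpa [hp] using h.symm
    simp [this] at hu

lemma cost_zero {q b : ℕ} (hb : 2 ≤ b) : cost q b 0 = 0 := by
  unfold cost
  simp [iterate_shift_zero hb, not_charged_zero (q := q) (b := b) (by omega)]

lemma cost_le_of_iterate_shift {q b : ℕ} (hb : 2 ≤ b) {s : ℕ} {c : ℤ}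
    (hc : (shift b)^[s] c = 0) : cost q b c ≤ s := by
  induction s generalizing c with
  | zero =>
    obtain rfl : c = 0 := hc
    simp [cost_zero hb]
  | succ s ih =>
    refine (cost_le_one_add q b c).trans ?_
    push_cast
    rw [add_comm]
    gcongr
    exact ih hc

lemma cost_pow_mul {q b : ℕ} (hb : 2 ≤ b) (g : ℕ) {w : ℤ} (hw : ¬ (q : ℤ) ∣ w) :
    cost q b ((b : ℤ) ^ g * w) = g + cost q b w := by
  classical
  induction g with
  | zero => simp
  | succ g ih =>
    rw [cost_eq, if_pos (show Charged q b _ from Or.inr ⟨g + 1, w, rfl, hw⟩), pow_succ', mul_assoc, shift_mul hb, ih]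
    push_cast
    ring

lemma cost_le_cost_pow_mul {q b : ℕ} (hb : 2 ≤ b) (g : ℕ) (w : ℤ) :
    cost q b w ≤ cost q b ((b : ℤ) ^ g * w) := by
  induction g with
  | zero => simp
  | succ g ih =>
    refine ih.trans ?_
    have := cost_shift_le q b ((b : ℤ) ^ (g + 1) * w)
    rwa [pow_succ', mul_assoc, shift_mul hb, ← mul_assoc, ← pow_succ'] at this

/-! ### Multiplication by an integer coprime to the base -/

lemma charged_of_charged_mul {q b : ℕ} (hb : b ≠ 0) {K : ℤ} (hK : IsCoprime K (b : ℤ)) {y : ℤ}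
    (h : Charged q b (K * y)) : Charged q b y := by
  rcases h with h | ⟨k, u, h, hu⟩
  · exact Or.inl fun h' => h (h'.mul_left K)
  · obtain ⟨v, rfl⟩ : (b : ℤ) ^ k ∣ y :=
      (hK.symm.pow_left).dvd_of_dvd_mul_left ⟨u, h⟩
    refine Or.inr ⟨k, v, rfl, fun hv => hu ?_⟩
    have : u = K * v :=
      mul_left_cancel₀ (pow_ne_zero k (Int.natCast_ne_zero.2 hb)) (by rw [← h]; ring)
    rw [this]
    exact hv.mul_left K

lemma shift_mul_add {b : ℕ} (hb : b ≠ 0) (K y c : ℤ) :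
    shift b (K * y + c) = K * shift b y + shift b (K * digit b y + c) := by
  have h := digit_add_mul_shift b y
  conv_lhs => rw [← h]
  rw [show K * (digit b y + b * shift b y) + c = (K * digit b y + c) + b * (K * shift b y) by ring,
    shift_add_mul hb]
  ring

lemma abs_carry_le {b : ℕ} (hb : 3 ≤ b) {K c : ℤ} (hc : |c| ≤ |K|) (y : ℤ) :
    |shift b (K * digit b y + c)| ≤ |K| := by
  have h := mul_abs_shift_le hb (K * digit b y + c)
  have h1 : |K * digit b y + c| ≤ |K| * (b - 2) + |K| := by
    refine (abs_add_le _ _).trans ?_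
    rw [abs_mul]
    have := abs_digit_le hb y
    have := abs_nonneg K
    nlinarith
  have hb' : (3 : ℤ) ≤ b := by exact_mod_cast hb
  have h0 := abs_nonneg K
  by_contra! hlt
  nlinarith

lemma exists_iterate_shift_mul {b : ℕ} (hb : 3 ≤ b) (K x : ℤ) (n : ℕ) :
    ∃ c : ℤ, |c| ≤ |K| ∧ (shift b)^[n] (K * x) = K * (shift b)^[n] x + c := by
  induction n with
  | zero => exact ⟨0, by simp, by simp⟩
  | succ n ih =>
    obtain ⟨c, hc, h⟩ := ih
    refine ⟨_, abs_carry_le hb hc ((shift b)^[n] x), ?_⟩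
    rw [Function.iterate_succ_apply', h, shift_mul_add (by omega), Function.iterate_succ_apply']

lemma cost_mul_add_le_aux {q b : ℕ} (hb : 3 ≤ b) {K : ℤ}
    (hK : IsCoprime K (b : ℤ)) {t : ℕ} (ht : ∀ c : ℤ, |c| ≤ |K| → (shift b)^[t] c = 0)
    (n : ℕ) (y : ℤ) (hy : y.natAbs ≤ n) (c : ℤ) (hc : |c| ≤ |K|) (s : ℕ)
    (hs : (shift b)^[s] c = 0) :
    cost q b (K * y + c) ≤ cost q b y + t * digitCount b y + s := by
  classical
  induction n generalizing y c s with
  | zero =>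
    obtain rfl : y = 0 := by simpa using hy
    rw [mul_zero, zero_add]
    exact (cost_le_of_iterate_shift (by omega) hs).trans le_add_self
  | succ n ih =>
    by_cases hy0 : y = 0
    · rw [hy0, mul_zero, zero_add]
      exact (cost_le_of_iterate_shift (by omega) hs).trans le_add_self
    have hn : (shift b y).natAbs ≤ n := by
      have := natAbs_shift_lt hb hy0
      omega
    have hc' := abs_carry_le hb hc y
    rw [cost_eq q b (K * y + c), shift_mul_add (by omega), cost_eq q b y, digitCount_eq b y]
    by_cases hd : (b : ℤ) ∣ y
    · have hd0 := (digit_eq_zero_iff hb y).2 hd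
      rw [hd0, mul_zero, zero_add] at hc' ⊢
      rw [if_pos hd, zero_add]
      rcases s with _ | s
      · obtain rfl : c = 0 := hs
        have := ih _ hn _ hc' 0 (by simp [shift_zero (b := b) (by omega)])
        rw [add_zero]
        calc _ ≤ (if Charged q b y then 1 else 0)
              + (cost q b (shift b y) + t * digitCount b (shift b y) + (0 : ℕ)) := by
              gcongr
              split_ifs with h1 h2
              · exact le_rfl
              · exact absurd (charged_of_charged_mul (by omega) hK h1) h2
              all_goals simp
          _ = _ := by push_cast; ring
      · have := ih _ hn _ hc' s hs
        calc _ ≤ 1 + (cost q b (shift b y) + t * digitCount b (shift b y) + s) := by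
              gcongr
              split_ifs <;> simp
          _ = cost q b (shift b y) + t * digitCount b (shift b y) + (s + 1 : ℕ) := by
              push_cast; ring
          _ ≤ _ := by gcongr; exact le_add_self
    · have := ih _ hn _ hc' t (ht _ hc')
      rw [if_pos (show Charged q b y from Or.inl hd), if_neg hd]
      calc _ ≤ 1 + (cost q b (shift b y) + t * digitCount b (shift b y) + t) := by
              gcongr
              split_ifs <;> simp
        _ = 1 + cost q b (shift b y) + t * (1 + digitCount b (shift b y)) := by ring
        _ ≤ _ := le_self_add

/-- Multiplication by `K` and adding a carry increases the cost by a bounded factor. -/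
lemma cost_mul_add_le {q b : ℕ} (hb : 3 ≤ b) {K : ℤ}
    (hK : IsCoprime K (b : ℤ)) {t : ℕ} (ht : ∀ c : ℤ, |c| ≤ |K| → (shift b)^[t] c = 0)
    (y : ℤ) {c : ℤ} (hc : |c| ≤ |K|) :
    cost q b (K * y + c) ≤ (t + 1 : ℕ) * (cost q b y + 1) := by
  refine (cost_mul_add_le_aux hb hK ht _ y le_rfl c hc t (ht c hc)).trans ?_
  calc _ ≤ cost q b y + t * cost q b y + t + 1 := by
        refine le_trans ?_ le_self_add
        gcongr
        exact digitCount_le_cost q b y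
    _ = _ := by push_cast; ring

/-! ### The Fourier transform of the Cantor measure -/

/-- The character `exp (-2 π i y)`. -/
def unitChar (y : ℝ) : ℂ := Complex.exp (-(2 * Real.pi * y : ℝ) * Complex.I)

lemma expFun_eq (l x : ℝ) : expFun l x = unitChar (l * x) := by
  unfold expFun unitChar
  rw [mul_assoc (2 * Real.pi) l x]

lemma unitChar_add (x y : ℝ) : unitChar (x + y) = unitChar x * unitChar y := by
  unfold unitChar
  rw [← Complex.exp_add]
  congr 1
  push_cast
  ring

lemma unitChar_zero : unitChar 0 = 1 := by simp [unitChar]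

lemma norm_unitChar (y : ℝ) : ‖unitChar y‖ = 1 := by
  rw [unitChar, ← Complex.ofReal_neg, Complex.norm_exp_ofReal_mul_I]

lemma conj_unitChar (y : ℝ) : (starRingEnd ℂ) (unitChar y) = unitChar (-y) := by
  unfold unitChar
  rw [← Complex.exp_conj]
  congr 1
  simp only [map_mul, map_neg, Complex.conj_I, Complex.conj_ofReal]
  push_cast
  ring

lemma unitChar_natCast_mul (n : ℕ) (y : ℝ) : unitChar (n * y) = unitChar y ^ n := by
  unfold unitChar
  rw [← Complex.exp_nat_mul]
  congr 1
  push_cast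
  ring

lemma unitChar_eq_one_iff (y : ℝ) : unitChar y = 1 ↔ ∃ n : ℤ, y = n := by
  unfold unitChar
  rw [Complex.exp_eq_one_iff]
  have hpi : (Real.pi : ℂ) ≠ 0 := by exact_mod_cast Real.pi_ne_zero
  constructor
  · rintro ⟨n, hn⟩
    refine ⟨-n, ?_⟩
    have h : (2 * Real.pi * Complex.I) * (y + n : ℂ) = 0 := by
      push_cast at hn
      linear_combination -hn
    have h2 : (y + n : ℂ) = 0 := by simpa [hpi] using h
    have h3 : y + n = 0 := by exact_mod_cast h2
    push_cast
    linarith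
  · rintro ⟨n, rfl⟩
    exact ⟨-n, by push_cast; ring⟩

lemma unitChar_intCast (n : ℤ) : unitChar n = 1 := (unitChar_eq_one_iff _).2 ⟨n, rfl⟩

lemma continuous_unitChar : Continuous unitChar := by
  unfold unitChar
  fun_prop

/-- The mask polynomial: the Fourier transform of the uniform measure on `{0, 1/q, …, (q-1)/q}`. -/
def mask (q : ℕ) (x : ℝ) : ℂ := (q : ℂ)⁻¹ * ∑ i ∈ Finset.range q, unitChar (x / q * i)

/-- The squared modulus of the mask polynomial. -/
def maskSq (q : ℕ) (x : ℝ) : ℝ := ‖mask q x‖ ^ 2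

lemma continuous_maskSq (q : ℕ) : Continuous (maskSq q) := by
  unfold maskSq mask
  have := continuous_unitChar
  fun_prop

lemma maskSq_nonneg (q : ℕ) (x : ℝ) : 0 ≤ maskSq q x := by
  unfold maskSq
  positivity

lemma maskSq_le_one (q : ℕ) [NeZero q] (x : ℝ) : maskSq q x ≤ 1 := by
  unfold maskSq mask
  refine pow_le_one₀ (norm_nonneg _) ?_
  have hq : (0 : ℝ) < q := by exact_mod_cast Nat.pos_of_ne_zero (NeZero.ne q)
  rw [norm_mul, norm_inv, Complex.norm_natCast, inv_mul_le_iff₀ hq, mul_one]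
  refine (norm_sum_le _ _).trans ?_
  simp [norm_unitChar]

lemma maskSq_add_mul (q : ℕ) [NeZero q] (x : ℝ) (n : ℤ) :
    maskSq q (x + q * n) = maskSq q x := by
  have hq : (q : ℝ) ≠ 0 := by exact_mod_cast NeZero.ne q
  unfold maskSq mask
  congr 3
  refine Finset.sum_congr rfl fun i _ => ?_
  have : (x + q * n) / q * (i : ℝ) = x / q * i + ((n * i : ℤ) : ℝ) := by
    push_cast
    field_simp
  rw [this, unitChar_add, unitChar_intCast, mul_one]

lemma maskSq_add_of_dvd (q : ℕ) [NeZero q] (x : ℝ) {m : ℤ} (hm : (q : ℤ) ∣ m) :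
    maskSq q (x + m) = maskSq q x := by
  obtain ⟨n, rfl⟩ := hm
  push_cast
  exact maskSq_add_mul q x n

lemma maskSq_add_congr (q : ℕ) [NeZero q] (x : ℝ) {m n : ℤ} (h : m ≡ n [ZMOD q]) :
    maskSq q (x + m) = maskSq q (x + n) := by
  have := maskSq_add_of_dvd q (x + m) (Int.modEq_iff_dvd.1 h)
  rw [← this]
  congr 1
  push_cast
  ring

lemma mask_mul (q : ℕ) [NeZero q] (x : ℝ) :
    mask q x * (q * (unitChar (x / q) - 1)) = unitChar x - 1 := by
  have hq : (q : ℂ) ≠ 0 := by exact_mod_cast NeZero.ne q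
  have hq' : (q : ℝ) ≠ 0 := by exact_mod_cast NeZero.ne q
  have hs : ∑ i ∈ Finset.range q, unitChar (x / q * i)
      = ∑ i ∈ Finset.range q, unitChar (x / q) ^ i :=
    Finset.sum_congr rfl fun i _ => by rw [mul_comm, unitChar_natCast_mul]
  have hg := geom_sum_mul (unitChar (x / q)) q
  rw [← unitChar_natCast_mul, mul_div_cancel₀ _ hq'] at hg
  rw [← hg, mask, hs]
  field_simp

lemma maskSq_intCast_eq_zero (q : ℕ) [NeZero q] {n : ℤ} (hn : ¬ (q : ℤ) ∣ n) :
    maskSq q n = 0 := by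
  have hq : (q : ℂ) ≠ 0 := by exact_mod_cast NeZero.ne q
  have hq' : (q : ℝ) ≠ 0 := by exact_mod_cast NeZero.ne q
  have h := mask_mul q n
  rw [unitChar_intCast, sub_self] at h
  have h1 : unitChar ((n : ℝ) / q) - 1 ≠ 0 := by
    rw [sub_ne_zero]
    intro h1
    obtain ⟨m, hm⟩ := (unitChar_eq_one_iff _).1 h1
    rw [div_eq_iff hq'] at hm
    exact hn ⟨m, by have : n = m * q := by exact_mod_cast hm
                    rw [this, mul_comm]⟩
  have h2 : mask q n = 0 := (mul_eq_zero.1 h).resolve_right (mul_ne_zero hq h1)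
  simp [maskSq, h2]

lemma maskSq_pos (q : ℕ) [NeZero q] {x : ℝ} (hx : ∀ n : ℤ, x ≠ n) : 0 < maskSq q x := by
  have h := mask_mul q x
  have h1 : unitChar x - 1 ≠ 0 := by
    rw [sub_ne_zero, Ne, unitChar_eq_one_iff]
    rintro ⟨n, hn⟩
    exact hx n hn
  have : mask q x ≠ 0 := by
    intro h0
    rw [h0, zero_mul] at h
    exact h1 h.symm
  unfold maskSq
  positivity

lemma maskSq_zero (q : ℕ) [NeZero q] : maskSq q 0 = 1 := by
  have hq : (q : ℂ) ≠ 0 := by exact_mod_cast NeZero.ne q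
  simp [maskSq, mask, unitChar_zero, hq]

lemma ne_intCast_of_abs_lt_one {x : ℝ} (h0 : x ≠ 0) (h1 : |x| < 1) (n : ℤ) : x ≠ n := by
  rintro rfl
  have : |n| < 1 := by exact_mod_cast h1
  rw [Int.abs_lt_one_iff] at this
  simp [this] at h0

lemma maskSq_pos_of_abs_lt_one (q : ℕ) [NeZero q] {x : ℝ} (hx : |x| < 1) : 0 < maskSq q x := by
  by_cases h0 : x = 0
  · rw [h0, maskSq_zero]
    exact one_pos
  · exact maskSq_pos q (ne_intCast_of_abs_lt_one h0 hx)

lemma sum_unitChar_div (q : ℕ) [NeZero q] (i k : ℕ) (hi : i < q) (hk : k < q) :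
    ∑ j ∈ Finset.range q, unitChar ((j : ℝ) * (((i : ℝ) - k) / q)) = if i = k then (q : ℂ) else 0 := by
  have hq' : (q : ℝ) ≠ 0 := by exact_mod_cast NeZero.ne q
  split_ifs with h
  · simp [h, unitChar_zero]
  · simp only [unitChar_natCast_mul]
    have hg := geom_sum_mul (unitChar (((i : ℝ) - k) / q)) q
    rw [← unitChar_natCast_mul, mul_div_cancel₀ _ hq',
      show ((i : ℝ) - k) = ((i - k : ℤ) : ℝ) by push_cast; ring, unitChar_intCast, sub_self] at hg
    rw [show ((i : ℝ) - k) = ((i - k : ℤ) : ℝ) by push_cast; ring]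
    refine (mul_eq_zero.1 hg).resolve_right ?_
    rw [← Ne, sub_ne_zero, Ne, unitChar_eq_one_iff]
    rintro ⟨m, hm⟩
    rw [div_eq_iff hq'] at hm
    have hm' : (i : ℤ) - k = m * q := by exact_mod_cast hm
    have hd : (q : ℤ) ∣ i - k := ⟨m, by rw [hm', mul_comm]⟩
    have := Int.eq_zero_of_abs_lt_dvd hd (by rw [abs_lt]; constructor <;> omega)
    omega

lemma sum_maskSq (q : ℕ) [NeZero q] (x : ℝ) :
    ∑ j ∈ Finset.range q, maskSq q (x + j) = 1 := by
  have hq : (q : ℂ) ≠ 0 := by exact_mod_cast NeZero.ne q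
  have hq' : (q : ℝ) ≠ 0 := by exact_mod_cast NeZero.ne q
  have key : ∀ j : ℕ, ((maskSq q (x + j) : ℝ) : ℂ) = ((q : ℂ)⁻¹) ^ 2 *
      ∑ i ∈ Finset.range q, ∑ k ∈ Finset.range q,
        unitChar (x / q * i) * unitChar (-(x / q * k)) * unitChar ((j : ℝ) * (((i : ℝ) - k) / q)) := by
    intro j
    rw [maskSq, Complex.ofReal_pow, ← Complex.mul_conj', mask, map_mul, map_inv₀, Complex.conj_natCast,
      map_sum, mul_mul_mul_comm, ← sq, Finset.sum_mul_sum]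
    congr 1
    refine Finset.sum_congr rfl fun i _ => Finset.sum_congr rfl fun k _ => ?_
    rw [conj_unitChar, ← unitChar_add, ← unitChar_add, ← unitChar_add]
    congr 1
    field_simp
    ring
  have h : ((∑ j ∈ Finset.range q, maskSq q (x + j) : ℝ) : ℂ) = 1 := by
    rw [Complex.ofReal_sum, Finset.sum_congr rfl fun j _ => key j, ← Finset.mul_sum,
      Finset.sum_comm]
    have h2 : ∀ i ∈ Finset.range q, ∑ j ∈ Finset.range q, ∑ k ∈ Finset.range q,
        unitChar (x / q * i) * unitChar (-(x / q * k)) * unitChar ((j : ℝ) * (((i : ℝ) - k) / q))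
        = q := by
      intro i hi
      rw [Finset.sum_comm, Finset.sum_eq_single i]
      · rw [← Finset.mul_sum, sum_unitChar_div q i i (Finset.mem_range.1 hi) (Finset.mem_range.1 hi),
          ← unitChar_add, add_neg_cancel, unitChar_zero, one_mul, if_pos rfl]
      · intro k hk hki
        rw [← Finset.mul_sum, sum_unitChar_div q i k (Finset.mem_range.1 hi) (Finset.mem_range.1 hk),
          if_neg hki.symm, mul_zero]
      · exact fun h => absurd hi h
    rw [Finset.sum_congr rfl h2]
    simp
    field_simp
  exact_mod_cast h

/-- The Fourier transform of the Cantor measure. -/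
def muHat (q b : ℕ) [NeZero q] (x : ℝ) : ℂ := ∫ y, unitChar (x * y) ∂cantorMeasure q b

/-- The squared modulus of the Fourier transform of the Cantor measure. -/
def hatSq (q b : ℕ) [NeZero q] (x : ℝ) : ℝ := ‖muHat q b x‖ ^ 2

lemma continuous_muHat (q b : ℕ) [NeZero q] : Continuous (muHat q b) := by
  have hc := continuous_unitChar
  refine continuous_of_dominated (bound := fun _ => 1) (fun x => ?_) (fun x => ?_)
    (integrable_const _) (ae_of_all _ fun y => ?_)
  · exact (by fun_prop : Continuous fun y => unitChar (x * y)).aestronglyMeasurable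
  · exact ae_of_all _ fun y => (norm_unitChar _).le
  · fun_prop

lemma continuous_hatSq (q b : ℕ) [NeZero q] : Continuous (hatSq q b) :=
  (continuous_muHat q b).norm.pow 2

lemma hatSq_zero (q b : ℕ) [NeZero q] : hatSq q b 0 = 1 := by
  simp [hatSq, muHat, unitChar_zero]

lemma hatSq_nonneg (q b : ℕ) [NeZero q] (x : ℝ) : 0 ≤ hatSq q b x := by
  unfold hatSq
  positivity

lemma hatSq_le_one (q b : ℕ) [NeZero q] (x : ℝ) : hatSq q b x ≤ 1 := by
  refine pow_le_one₀ (norm_nonneg _) ?_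
  refine (norm_integral_le_integral_norm _).trans ?_
  simp [norm_unitChar]

lemma hatSq_neg (q b : ℕ) [NeZero q] (x : ℝ) : hatSq q b (-x) = hatSq q b x := by
  unfold hatSq
  congr 1
  rw [← RCLike.norm_conj (muHat q b x), muHat, muHat, ← integral_conj]
  simp only [conj_unitChar, neg_mul]

lemma muHat_eq (q b : ℕ) [NeZero q] (hb : 2 ≤ b) (x : ℝ) :
    muHat q b x = mask q x * muHat q b (x / b) := by
  have hc := continuous_unitChar
  have hq : (q : ℝ) ≠ 0 := by exact_mod_cast NeZero.ne q
  have hint : ∀ ν : Measure ℝ, IsFiniteMeasure ν → Integrable (fun y => unitChar (x * y)) ν := by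
    intro ν _
    exact Integrable.of_bound (C := 1)
      (by fun_prop : Continuous fun y => unitChar (x * y)).aestronglyMeasurable
      (ae_of_all _ fun y => (norm_unitChar _).le)
  conv_lhs => rw [muHat, cantorMeasure_selfSimilar q b hb]
  rw [integral_smul_measure, integral_finsetSum_measure]
  · have : ∀ i : Fin q, ∫ y, unitChar (x * y) ∂(cantorMeasure q b).map
        (fun y : ℝ => y / b + ((i : ℕ) : ℝ) / q) = unitChar (x / q * (i : ℕ)) * muHat q b (x / b) := by
      intro i
      rw [integral_map (by fun_prop)
        (by fun_prop : Continuous fun y => unitChar (x * y)).aestronglyMeasurable, muHat,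
        ← integral_const_mul]
      congr 1
      ext y
      rw [← unitChar_add]
      congr 1
      ring
    rw [Finset.sum_congr rfl fun i _ => this i, ← Finset.sum_mul,
      Fin.sum_univ_eq_sum_range (fun i => unitChar (x / q * (i : ℕ))), mask]
    simp [mul_assoc]
  · intro i _
    have : IsFiniteMeasure ((cantorMeasure q b).map (fun y : ℝ => y / b + ((i : ℕ) : ℝ) / q)) :=
      Measure.isFiniteMeasure_map _ _
    exact hint _ this

lemma hatSq_eq (q b : ℕ) [NeZero q] (hb : 2 ≤ b) (x : ℝ) :
    hatSq q b x = maskSq q x * hatSq q b (x / b) := by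
  unfold hatSq maskSq
  rw [muHat_eq q b hb, norm_mul, mul_pow]

/-- The squared modulus of the Fourier transform of the level `n` approximation of the Cantor
measure. -/
def maskProd (q b n : ℕ) (x : ℝ) : ℝ := ∏ k ∈ Finset.range n, maskSq q (x / (b : ℝ) ^ k)

lemma maskProd_succ (q b n : ℕ) (x : ℝ) :
    maskProd q b (n + 1) x = maskProd q b n x * maskSq q (x / (b : ℝ) ^ n) :=
  Finset.prod_range_succ _ _

lemma maskProd_nonneg (q b n : ℕ) (x : ℝ) : 0 ≤ maskProd q b n x :=
  Finset.prod_nonneg fun _ _ => maskSq_nonneg _ _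

lemma hatSq_eq_maskProd (q b : ℕ) [NeZero q] (hb : 2 ≤ b) (n : ℕ) (x : ℝ) :
    hatSq q b x = maskProd q b n x * hatSq q b (x / (b : ℝ) ^ n) := by
  induction n with
  | zero => simp [maskProd]
  | succ n ih =>
    rw [ih, maskProd_succ, hatSq_eq q b hb (x / (b : ℝ) ^ n), div_div, ← pow_succ, mul_assoc]

lemma maskProd_add_mul (q b : ℕ) [NeZero q] (hqb : q ∣ b) (hb : b ≠ 0) (n : ℕ) (x : ℝ) (v : ℤ) :
    maskProd q b n (x + (b : ℝ) ^ n * v) = maskProd q b n x := by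
  have hb' : (b : ℝ) ≠ 0 := by exact_mod_cast hb
  refine Finset.prod_congr rfl fun k hk => ?_
  obtain ⟨j, rfl⟩ := Nat.exists_eq_add_of_lt (Finset.mem_range.1 hk)
  have h : (x + (b : ℝ) ^ (k + j + 1) * v) / (b : ℝ) ^ k
      = x / (b : ℝ) ^ k + (((b : ℤ) * ((b : ℤ) ^ j * v) : ℤ) : ℝ) := by
    push_cast
    field_simp
    ring
  rw [h]
  exact maskSq_add_of_dvd q _ ((Int.natCast_dvd_natCast.2 hqb).mul_right _)

lemma maskProd_congr (q b : ℕ) [NeZero q] (hqb : q ∣ b) (hb : b ≠ 0) {n : ℕ} (x : ℝ) {r s : ℤ}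
    (h : (b : ℤ) ^ n ∣ s - r) : maskProd q b n (x + s) = maskProd q b n (x + r) := by
  obtain ⟨v, hv⟩ := h
  rw [← maskProd_add_mul q b hqb hb n (x + r) v]
  congr 1
  have : (s : ℝ) - r = (b : ℝ) ^ n * v := by exact_mod_cast hv
  linarith

lemma hatSq_le_maskProd (q b : ℕ) [NeZero q] (hb : 2 ≤ b) (n : ℕ) (x : ℝ) :
    hatSq q b x ≤ maskProd q b n x := by
  rw [hatSq_eq_maskProd q b hb n]
  exact mul_le_of_le_one_right (maskProd_nonneg _ _ _ _) (hatSq_le_one _ _ _)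

lemma hatSq_le_maskSq (q b : ℕ) [NeZero q] (hb : 2 ≤ b) (x : ℝ) :
    hatSq q b x ≤ maskSq q x := by
  simpa [maskProd] using hatSq_le_maskProd q b hb 1 x

lemma tendsto_div_pow {b : ℕ} (hb : 2 ≤ b) (x : ℝ) :
    Tendsto (fun n : ℕ => x / (b : ℝ) ^ n) atTop (nhds 0) := by
  have h1 : (1 : ℝ) < b := by exact_mod_cast (by omega : 1 < b)
  exact tendsto_const_nhds.div_atTop (tendsto_pow_atTop_atTop_of_one_lt h1)

lemma tendsto_hatSq_div_pow (q b : ℕ) [NeZero q] (hb : 2 ≤ b) (x : ℝ) :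
    Tendsto (fun n : ℕ => hatSq q b (x / (b : ℝ) ^ n)) atTop (nhds 1) := by
  rw [← hatSq_zero q b]
  exact ((continuous_hatSq q b).tendsto 0).comp (tendsto_div_pow hb x)

lemma tendsto_maskProd (q b : ℕ) [NeZero q] (hb : 2 ≤ b) (x : ℝ) :
    Tendsto (fun n : ℕ => maskProd q b n x) atTop (nhds (hatSq q b x)) := by
  have h1 := tendsto_hatSq_div_pow q b hb x
  have h2 : Tendsto (fun n : ℕ => hatSq q b x / hatSq q b (x / (b : ℝ) ^ n)) atTop
      (nhds (hatSq q b x / 1)) := tendsto_const_nhds.div h1 one_ne_zero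
  rw [div_one] at h2
  refine h2.congr' ?_
  filter_upwards [h1.eventually_ne one_ne_zero] with n hn
  rw [hatSq_eq_maskProd q b hb n x, mul_div_assoc, div_self hn, mul_one]

lemma hatSq_intCast_eq_zero (q b : ℕ) [NeZero q] (hb : 2 ≤ b) {z : ℤ} (hz : InZeroSet q b z) :
    hatSq q b z = 0 := by
  obtain ⟨k, u, rfl, hu⟩ := hz
  have hb' : (b : ℝ) ≠ 0 := by exact_mod_cast (by omega : b ≠ 0)
  rw [hatSq_eq_maskProd q b hb (k + 1), maskProd_succ]
  have : (((b : ℤ) ^ k * u : ℤ) : ℝ) / (b : ℝ) ^ k = u := by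
    push_cast
    field_simp
  rw [this, maskSq_intCast_eq_zero q hu]
  ring

lemma hatSq_pos_of_abs_lt_one (q b : ℕ) [NeZero q] (hb : 2 ≤ b) {x : ℝ} (hx : |x| < 1) :
    0 < hatSq q b x := by
  have h1 := tendsto_hatSq_div_pow q b hb x
  obtain ⟨n, hn⟩ := (h1.eventually (lt_mem_nhds one_pos)).exists
  rw [hatSq_eq_maskProd q b hb n]
  refine mul_pos (Finset.prod_pos fun k _ => maskSq_pos_of_abs_lt_one q ?_) hn
  have hb1 : (1 : ℝ) ≤ (b : ℝ) ^ k := one_le_pow₀ (by exact_mod_cast (by omega : 1 ≤ b))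
  rw [abs_div, abs_of_pos (by linarith : (0 : ℝ) < (b : ℝ) ^ k)]
  exact (div_le_self (abs_nonneg _) hb1).trans_lt hx

lemma exists_le_hatSq (q b : ℕ) [NeZero q] (hb : 2 ≤ b) {ρ : ℝ} (hρ : ρ < 1) :
    ∃ a > 0, ∀ t : ℝ, |t| ≤ ρ → a ≤ hatSq q b t := by
  have hK : IsCompact {t : ℝ | |t| ≤ ρ} := by
    simpa [Metric.closedBall, Real.dist_eq] using isCompact_closedBall (0 : ℝ) ρ
  obtain ⟨a, ha, h⟩ := hK.exists_forall_le' (f := hatSq q b) (a := 0)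
    (continuous_hatSq q b).continuousOn
    (fun t ht => hatSq_pos_of_abs_lt_one q b hb (lt_of_le_of_lt ht hρ))
  exact ⟨a, ha, h⟩

lemma exists_le_maskSq (q : ℕ) [NeZero q] {ρ η : ℝ} (hρ : ρ < 1) (hη : 0 < η) :
    ∃ a > 0, ∀ t : ℝ, η ≤ |t| → |t| ≤ ρ → ∀ d : ℤ, a ≤ maskSq q (t + d) := by
  have hK : IsCompact {t : ℝ | η ≤ |t| ∧ |t| ≤ ρ} := by
    have h1 : IsCompact {t : ℝ | |t| ≤ ρ} := by
      simpa [Metric.closedBall, Real.dist_eq] using isCompact_closedBall (0 : ℝ) ρ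
    exact h1.inter_left (isClosed_le continuous_const continuous_abs)
  have hc := continuous_maskSq q
  obtain ⟨a, ha, h⟩ := hK.exists_forall_le'
    (f := fun t => ∏ j ∈ Finset.range q, maskSq q (t + j)) (a := 0)
    (by fun_prop) (fun t ht => Finset.prod_pos fun j _ => maskSq_pos q fun n hn => by
      refine ne_intCast_of_abs_lt_one (x := t) ?_ (lt_of_le_of_lt ht.2 hρ) (n - j) ?_
      · intro h0
        have := ht.1
        rw [h0, abs_zero] at this
        linarith
      · push_cast
        linarith)
  refine ⟨a, ha, fun t h1 h2 d => (h t ⟨h1, h2⟩).trans ?_⟩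
  have hq : (0 : ℤ) < q := by exact_mod_cast Nat.pos_of_ne_zero (NeZero.ne q)
  have hlt := Int.emod_lt_of_pos d hq
  have hnn := Int.emod_nonneg d hq.ne'
  lift d % (q : ℤ) to ℕ using hnn with j hj
  have hjq : j ∈ Finset.range q := Finset.mem_range.2 (by exact_mod_cast hlt)
  have heq : maskSq q (t + d) = maskSq q (t + j) := by
    have := maskSq_add_congr q t (m := d) (n := j) (by rw [hj]; exact (Int.mod_modEq d q).symm)
    exact_mod_cast this
  rw [heq, ← Finset.mul_prod_erase _ _ hjq]
  exact mul_le_of_le_one_right (maskSq_nonneg _ _)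
    (Finset.prod_le_one (fun _ _ => maskSq_nonneg _ _) fun _ _ => maskSq_le_one _ _)

/-! ### Lower bounds for the Fourier transform -/

lemma exists_mul_hatSq_le (q b : ℕ) [NeZero q] (hqb : q ∣ b) (hb : 2 ≤ b) {ρ : ℝ} (hρ : ρ < 1) :
    ∃ a > 0, ∀ t : ℝ, |t| ≤ ρ → a ≤ hatSq q b t ∧
      ∀ (g : ℕ) (w : ℤ), a * hatSq q b (t / (b : ℝ) ^ g + w) ≤ hatSq q b (t + (b : ℝ) ^ g * w) := by
  obtain ⟨a, ha, h⟩ := exists_le_hatSq q b hb hρ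
  refine ⟨a, ha, fun t ht => ⟨h t ht, fun g w => ?_⟩⟩
  have hb' : (b : ℝ) ≠ 0 := by exact_mod_cast (by omega : b ≠ 0)
  rw [hatSq_eq_maskProd q b hb g (t + (b : ℝ) ^ g * w), maskProd_add_mul q b hqb (by omega),
    show (t + (b : ℝ) ^ g * w) / (b : ℝ) ^ g = t / (b : ℝ) ^ g + w by field_simp]
  exact mul_le_mul_of_nonneg_right ((h t ht).trans (hatSq_le_maskProd q b hb g t))
    (hatSq_nonneg _ _ _)

lemma hatSq_add_digit (q b : ℕ) [NeZero q] (hb : 2 ≤ b) (t : ℝ) (d y : ℤ) (hqb : q ∣ b) :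
    hatSq q b (t + ((d + b * y : ℤ) : ℝ)) = maskSq q (t + d) * hatSq q b ((t + d) / b + y) := by
  have hb' : (b : ℝ) ≠ 0 := by exact_mod_cast (by omega : b ≠ 0)
  rw [hatSq_eq q b hb]
  congr 1
  · have := maskSq_add_of_dvd q (t + d) (m := b * y)
      ((Int.natCast_dvd_natCast.2 hqb).mul_right _)
    rw [← this]
    congr 1
    push_cast
    ring
  · congr 1
    push_cast
    field_simp
    ring

lemma abs_div_pow_le {b : ℕ} (hb : 2 ≤ b) (g : ℕ) {t ρ : ℝ} (ht : |t| ≤ ρ) :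
    |t / (b : ℝ) ^ g| ≤ ρ := by
  have hb1 : (1 : ℝ) ≤ (b : ℝ) ^ g := one_le_pow₀ (by exact_mod_cast (by omega : 1 ≤ b))
  rw [abs_div, abs_of_pos (by linarith : (0 : ℝ) < (b : ℝ) ^ g)]
  exact (div_le_self (abs_nonneg _) hb1).trans ht

lemma abs_add_digit_div_mem {b : ℕ} (hb : 3 ≤ b) {t : ℝ} (ht : |t| ≤ 1 - 1 / b) {d : ℤ}
    (hd0 : d ≠ 0) (hd : |d| ≤ (b : ℤ) - 2) :
    1 / (b : ℝ) ^ 2 ≤ |(t + d) / b| ∧ |(t + d) / b| ≤ 1 - 1 / b := by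
  have hb' : (0 : ℝ) < b := by exact_mod_cast (by omega : 0 < b)
  have h1 : (1 : ℝ) ≤ |(d : ℝ)| := by exact_mod_cast Int.one_le_abs hd0
  have h2 : |(d : ℝ)| ≤ b - 2 := by exact_mod_cast hd
  have h3 : |(d : ℝ)| - |t| ≤ |t + d| := by
    have := abs_sub_abs_le_abs_sub (d : ℝ) (-t)
    rw [abs_neg] at this
    rwa [show t + (d : ℝ) = d - -t by ring]
  have h4 := abs_add_le t (d : ℝ)
  have h5 : 0 < 1 / (b : ℝ) := by positivity
  rw [abs_div, abs_of_pos hb']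
  constructor
  · rw [sq, ← div_div]
    gcongr
    linarith
  · rw [div_le_iff₀ hb']
    have : (1 - 1 / (b : ℝ)) * b = b - 1 := by field_simp
    rw [this]
    linarith

lemma one_sub_inv_lt_one {b : ℕ} (hb : 2 ≤ b) : 1 - 1 / (b : ℝ) < 1 := by
  have hb' : (0 : ℝ) < b := by exact_mod_cast (by omega : 0 < b)
  have : 0 < 1 / (b : ℝ) := by positivity
  linarith

lemma exists_eq_pow_mul {b : ℕ} (hb : 2 ≤ b) {y : ℤ} (hy : y ≠ 0) :
    ∃ (g : ℕ) (w : ℤ), y = (b : ℤ) ^ g * w ∧ ¬ (b : ℤ) ∣ w := by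
  have hfin : FiniteMultiplicity (b : ℤ) y :=
    Int.finiteMultiplicity_iff.2 ⟨by simp; omega, hy⟩
  obtain ⟨w, h1, h2⟩ := hfin.exists_eq_pow_mul_and_not_dvd
  exact ⟨_, w, h1, h2⟩

/-- The Fourier transform is bounded below at the sum of a small number, not too close to zero,
and an integer of bounded cost. -/
lemma exists_le_hatSq_of_cost_le (q b : ℕ) [NeZero q] (hqb : q ∣ b) (hb : 3 ≤ b) (N : ℕ) :
    ∃ c > 0, ∀ y : ℤ, cost q b y ≤ N → ∀ t : ℝ, 1 / (b : ℝ) ^ 2 ≤ |t| → |t| ≤ 1 - 1 / b →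
      c ≤ hatSq q b (t + y) := by
  classical
  have hρ := one_sub_inv_lt_one (b := b) (by omega)
  have hb0 : (0 : ℝ) < b := by exact_mod_cast (by omega : 0 < b)
  obtain ⟨a, ha, hmul⟩ := exists_mul_hatSq_le q b hqb (by omega) hρ
  induction N with
  | zero =>
    refine ⟨a, ha, fun y hy t _ ht => ?_⟩
    have hy0 : y = 0 := by
      by_contra hne
      obtain ⟨g, w, rfl, hw⟩ := exists_eq_pow_mul (b := b) (by omega) hne
      have h1 : cost q b w ≤ 0 := (cost_le_cost_pow_mul (by omega) g w).trans hy
      rw [cost_eq, if_pos (show Charged q b w from Or.inl hw)] at h1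
      have h2 := (le_self_add : (1 : ℕ∞) ≤ 1 + cost q b (shift b w)).trans h1
      simp at h2
    rw [hy0, Int.cast_zero, add_zero]
    exact (hmul t ht).1
  | succ N ih =>
    obtain ⟨c, hc, ih⟩ := ih
    obtain ⟨a', ha', hmask⟩ := exists_le_maskSq q hρ
      (by positivity : 0 < 1 / (b : ℝ) ^ 2 / (b : ℝ) ^ N)
    have hmin : 0 < min a a' := lt_min ha ha'
    refine ⟨min (a * (min a a' * c)) a, lt_min (by positivity) ha, fun y hy t ht1 ht2 => ?_⟩
    by_cases hy0 : y = 0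
    · rw [hy0, Int.cast_zero, add_zero]
      exact (min_le_right _ _).trans (hmul t ht2).1
    refine (min_le_left _ _).trans ?_
    obtain ⟨g, w, rfl, hw⟩ := exists_eq_pow_mul (b := b) (by omega) hy0
    have hcw : cost q b w = 1 + cost q b (shift b w) := by
      rw [cost_eq, if_pos (show Charged q b w from Or.inl hw)]
    have hd0 : digit b w ≠ 0 := fun h => hw ((digit_eq_zero_iff hb w).1 h)
    have htg := abs_div_pow_le (b := b) (by omega) g ht2
    have hmem := abs_add_digit_div_mem hb htg hd0 (abs_digit_le hb w)
    have hcs : cost q b (shift b w) ≤ N := by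
      have h1 := (cost_le_cost_pow_mul (q := q) (b := b) (by omega) g w).trans hy
      rw [hcw, add_comm] at h1
      push_cast at h1
      exact (ENat.add_le_add_iff_right ENat.one_ne_top).1 h1
    have hm : min a a' ≤ maskSq q (t / (b : ℝ) ^ g + digit b w) := by
      by_cases hqw : (q : ℤ) ∣ digit b w
      · rw [maskSq_add_of_dvd q _ hqw]
        refine (min_le_left _ _).trans ((hmul _ htg).1.trans (hatSq_le_maskSq q b (by omega) _))
      · refine (min_le_right _ _).trans (hmask _ ?_ htg _)
        have hg : g ≤ N := by
          rw [dvd_digit_iff hqb] at hqw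
          rw [cost_pow_mul (by omega) g hqw, hcw] at hy
          have h1 : ((g + 1 : ℕ) : ℕ∞) ≤ (N + 1 : ℕ) := by
            refine le_trans ?_ hy
            push_cast
            rw [← add_assoc]
            exact le_self_add
          have h2 : g + 1 ≤ N + 1 := by exact_mod_cast h1
          omega
        have hb1 : (1 : ℝ) ≤ b := by exact_mod_cast (by omega : 1 ≤ b)
        rw [abs_div, abs_of_pos (by positivity : (0 : ℝ) < (b : ℝ) ^ g)]
        gcongr
    calc a * (min a a' * c)
        ≤ a * hatSq q b (t / (b : ℝ) ^ g + w) := by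
          gcongr
          conv_rhs => rw [← digit_add_mul_shift b w, hatSq_add_digit q b (by omega) _ _ _ hqb]
          gcongr
          · exact maskSq_nonneg _ _
          · exact ih _ hcs _ hmem.1 hmem.2
      _ ≤ _ := by
          have := (hmul t ht2).2 g w
          push_cast
          exact this

/-! ### Sets of integers with the structure of a tree -/

/-- Sets of integers whose residues modulo the powers of `b` form a `q`-adic tree. -/
structure IsDigitTree (q b : ℕ) (Λ : Set ℤ) : Prop where
  nonempty : Λ.Nonempty
  sub_mem : ∀ x ∈ Λ, ∀ y ∈ Λ, x ≠ y → InZeroSet q b (x - y)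
  child : ∀ x ∈ Λ, ∀ (n : ℕ) (j : ℤ), ∃ y ∈ Λ, ∃ v : ℤ, y - x = (b : ℤ) ^ n * v ∧ v ≡ j [ZMOD q]

/-- Every level of the tree meets `Λ` in elements whose remaining digits have bounded cost. -/
def HasCostBound (q b : ℕ) (Λ : Set ℤ) (D : ℕ) : Prop :=
  ∀ x ∈ Λ, ∀ n : ℕ, 1 ≤ n → ∃ z ∈ Λ, (b : ℤ) ^ n ∣ z - x ∧ cost q b ((shift b)^[n] z) ≤ D

lemma exists_level {q b : ℕ} [NeZero q] (hqb : q ∣ b) (hb : 2 ≤ b) {Λ : Set ℤ}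
    (hΛ : IsDigitTree q b Λ) (n : ℕ) :
    ∃ R : Finset ℤ, (∀ r ∈ R, r ∈ Λ) ∧ (∀ r ∈ R, ∀ s ∈ R, (b : ℤ) ^ n ∣ s - r → r = s) ∧
      (∀ x ∈ Λ, ∃ r ∈ R, (b : ℤ) ^ n ∣ x - r) ∧
      ∀ ξ : ℝ, ∑ r ∈ R, maskProd q b n (ξ + r) = 1 := by
  classical
  have hb0 : (b : ℤ) ≠ 0 := by exact_mod_cast (by omega : b ≠ 0)
  have hbR : (b : ℝ) ≠ 0 := by exact_mod_cast (by omega : b ≠ 0)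
  have hq0 : (0 : ℤ) < q := by exact_mod_cast Nat.pos_of_ne_zero (NeZero.ne q)
  have hqb' : (q : ℤ) ∣ b := Int.natCast_dvd_natCast.2 hqb
  induction n with
  | zero =>
    obtain ⟨x, hx⟩ := hΛ.nonempty
    refine ⟨{x}, by simpa using hx, by simp, fun y _ => ⟨x, by simp, by simp⟩, fun ξ => ?_⟩
    simp [maskProd]
  | succ n ih =>
    obtain ⟨R, hR, hinj, hcov, hsum⟩ := ih
    have hch : ∀ r ∈ R, ∀ j : ℕ, ∃ y ∈ Λ, ∃ v : ℤ, y - r = (b : ℤ) ^ n * v ∧ v ≡ j [ZMOD q] :=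
      fun r hr j => hΛ.child r (hR r hr) n j
    choose! y hy v hv hvj using hch
    have hdiv : ∀ r ∈ R, ∀ j, (b : ℤ) ^ n ∣ y r j - r := fun r hr j => ⟨_, hv r hr j⟩
    have hsep : ∀ r ∈ R, ∀ s ∈ R, ∀ j ∈ Finset.range q, ∀ k ∈ Finset.range q,
        (b : ℤ) ^ (n + 1) ∣ y s k - y r j → r = s ∧ j = k := by
      intro r hr s hs j hj k hk h
      have hrs : r = s := by
        refine hinj r hr s hs ?_
        have h1 : (b : ℤ) ^ n ∣ y s k - y r j := (pow_dvd_pow _ (by omega)).trans h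
        have h2 := (h1.add (hdiv r hr j)).sub (hdiv s hs k)
        rwa [show y s k - y r j + (y r j - r) - (y s k - s) = s - r by ring] at h2
      subst hrs
      refine ⟨rfl, ?_⟩
      obtain ⟨u, hu⟩ := h
      have h1 : v r k - v r j = b * u := by
        apply mul_left_cancel₀ (pow_ne_zero n hb0)
        have h1 := hv r hr k
        have h2 := hv r hr j
        rw [pow_succ] at hu
        linear_combination hu - h1 + h2
      have h2 : v r j ≡ v r k [ZMOD q] := Int.modEq_iff_dvd.2 (by rw [h1]; exact hqb'.mul_right _)
      have h3 : (j : ℤ) ≡ k [ZMOD q] := ((hvj r hr j).symm.trans h2).trans (hvj r hr k)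
      have h4 : j ≡ k [MOD q] := (Int.natCast_modEq_iff).1 h3
      exact h4.eq_of_lt_of_lt (Finset.mem_range.1 hj) (Finset.mem_range.1 hk)
    refine ⟨(R ×ˢ Finset.range q).image fun p => y p.1 p.2, ?_, ?_, ?_, ?_⟩
    · intro x hx
      simp only [Finset.mem_image, Finset.mem_product, Prod.exists] at hx
      obtain ⟨r, j, ⟨hr, _⟩, rfl⟩ := hx
      exact hy r hr j
    · intro x hx x' hx' h
      simp only [Finset.mem_image, Finset.mem_product, Prod.exists] at hx hx'
      obtain ⟨r, j, ⟨hr, hj⟩, rfl⟩ := hx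
      obtain ⟨s, k, ⟨hs, hk⟩, rfl⟩ := hx'
      obtain ⟨rfl, rfl⟩ := hsep r hr s hs j hj k hk h
      rfl
    · intro x hx
      obtain ⟨r, hr, u, hu⟩ := hcov x hx
      have hnn := Int.emod_nonneg u hq0.ne'
      have hlt := Int.emod_lt_of_pos u hq0
      have hmod := Int.mod_modEq u q
      lift u % (q : ℤ) to ℕ using hnn with j
      refine ⟨y r j, Finset.mem_image.2 ⟨(r, j), by simpa [hr] using hlt, rfl⟩, ?_⟩
      have hqd : (q : ℤ) ∣ u - v r j := Int.modEq_iff_dvd.1 ((hvj r hr j).trans hmod)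
      have hxy : x - y r j = (b : ℤ) ^ n * (u - v r j) := by
        have := hv r hr j
        linear_combination hu - this
      by_cases hne : x = y r j
      · rw [hne, sub_self]
        exact dvd_zero _
      obtain ⟨k, w, hk, hw⟩ := hΛ.sub_mem x hx _ (hy r hr j) hne
      have hnk : n < k := by
        by_contra! hkn
        obtain ⟨m, rfl⟩ := Nat.exists_eq_add_of_le hkn
        refine hw ?_
        have : w = (b : ℤ) ^ m * (u - v r j) := by
          apply mul_left_cancel₀ (pow_ne_zero k hb0)
          rw [← hk, hxy, pow_add]
          ring
        rw [this]
        exact hqd.mul_left _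
      rw [hk]
      exact (pow_dvd_pow _ hnk).mul_right _
    · intro ξ
      rw [Finset.sum_image, Finset.sum_product, ← hsum ξ]
      · refine Finset.sum_congr rfl fun r hr => ?_
        have h1 : ∀ j ∈ Finset.range q, maskProd q b (n + 1) (ξ + y r j)
            = maskProd q b n (ξ + r) * maskSq q ((ξ + r) / (b : ℝ) ^ n + j) := by
          intro j _
          rw [maskProd_succ, maskProd_congr q b hqb (by omega) ξ (hdiv r hr j)]
          congr 1
          have h2 : (y r j : ℝ) = r + (b : ℝ) ^ n * v r j := by
            have := hv r hr j
            have : y r j = r + (b : ℤ) ^ n * v r j := by linarith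
            exact_mod_cast this
          have h3 := maskSq_add_congr q ((ξ + r) / (b : ℝ) ^ n) (hvj r hr j)
          rw [Int.cast_natCast] at h3
          rw [← h3, h2]
          congr 1
          field_simp
          ring
        rw [Finset.sum_congr rfl h1, ← Finset.mul_sum, sum_maskSq, mul_one]
      · rintro ⟨r, j⟩ hp ⟨s, k⟩ hp' h
        simp only [Finset.coe_product, Set.mem_prod, Finset.mem_coe] at hp hp'
        obtain ⟨h1, h2⟩ := hsep r hp.1 s hp'.1 j hp.2 k hp'.2 (by
          have h' : y r j = y s k := h
          rw [h', sub_self]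
          exact dvd_zero _)
        rw [h1, h2]

lemma eventually_abs_lowPart_div_le {b : ℕ} (hb : 3 ≤ b) (ξ : ℝ) :
    ∀ᶠ n : ℕ in atTop, ∀ x : ℤ, |(ξ + lowPart b n x) / (b : ℝ) ^ n| ≤ 1 - 1 / b := by
  have hb' : (3 : ℝ) ≤ b := by exact_mod_cast hb
  have hpos : (0 : ℝ) < 1 / (b * (b - 1)) := by
    apply div_pos one_pos
    nlinarith
  have h := (tendsto_div_pow (b := b) (by omega) |ξ|).eventually (gt_mem_nhds hpos)
  filter_upwards [h] with n hn x
  have hp : (0 : ℝ) < (b : ℝ) ^ n := by positivity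
  have hx : ((b : ℝ) - 1) * |(lowPart b n x : ℝ)| ≤ (b - 2) * (b : ℝ) ^ n := by
    exact_mod_cast abs_lowPart_le hb n x
  have hx' : |(lowPart b n x : ℝ)| / (b : ℝ) ^ n ≤ (b - 2) / (b - 1) := by
    rw [div_le_div_iff₀ hp (by linarith)]
    linarith
  rw [abs_div, abs_of_pos hp]
  calc |ξ + lowPart b n x| / (b : ℝ) ^ n
      ≤ |ξ| / (b : ℝ) ^ n + |(lowPart b n x : ℝ)| / (b : ℝ) ^ n := by
        rw [← add_div]
        gcongr
        exact abs_add_le _ _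
    _ ≤ 1 / (b * (b - 1)) + (b - 2) / (b - 1) := by gcongr
    _ = 1 - 1 / b := by
        have : (b : ℝ) - 1 ≠ 0 := by linarith
        field_simp
        ring

/-- Every residue class of `Λ` contains an element at which the tail of the Fourier transform is
bounded below. -/
lemma exists_le_hatSq_tail {q b : ℕ} [NeZero q] (hqb : q ∣ b) (hb : 3 ≤ b) {Λ : Set ℤ}
    (hΛ : IsDigitTree q b Λ) {D : ℕ} (hD : HasCostBound q b Λ D)
    (hcl : ∀ T : ℤ, (∀ n : ℕ, ∃ x ∈ Λ, (b : ℤ) ^ n ∣ x - T) → T ∈ Λ) :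
    ∃ c > 0, ∀ ξ : ℝ, ∀ᶠ n : ℕ in atTop, ∀ x ∈ Λ, ∃ z ∈ Λ, (b : ℤ) ^ n ∣ z - x ∧
      c ≤ hatSq q b ((ξ + z) / (b : ℝ) ^ n) := by
  classical
  have hρ := one_sub_inv_lt_one (b := b) (by omega)
  have hb0 : (b : ℤ) ≠ 0 := by exact_mod_cast (by omega : b ≠ 0)
  have hbR : (b : ℝ) ≠ 0 := by exact_mod_cast (by omega : b ≠ 0)
  obtain ⟨a, ha, hmul⟩ := exists_mul_hatSq_le q b hqb (by omega) hρ
  obtain ⟨c, hc, hcost⟩ := exists_le_hatSq_of_cost_le q b hqb hb D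
  refine ⟨min a (a * (a * c)), lt_min ha (by positivity), fun ξ => ?_⟩
  filter_upwards [eventually_abs_lowPart_div_le hb ξ] with n hn x hx
  set T := lowPart b n x with hT
  have hTx : (b : ℤ) ^ n ∣ T - x := ⟨-(shift b)^[n] x, by
    have := lowPart_add b n x
    linear_combination this⟩
  have ht := hn x
  rw [← hT] at ht
  by_cases hTΛ : T ∈ Λ
  · exact ⟨T, hTΛ, hTx, (min_le_left _ _).trans (hmul _ ht).1⟩
  have hex : ∃ k : ℕ, ¬ ∃ y ∈ Λ, (b : ℤ) ^ k ∣ y - T := by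
    by_contra! h
    exact hTΛ (hcl T h)
  obtain ⟨k, hk, hkmin⟩ : ∃ k : ℕ, (¬ ∃ y ∈ Λ, (b : ℤ) ^ k ∣ y - T) ∧
      ∀ j < k, ∃ y ∈ Λ, (b : ℤ) ^ j ∣ y - T :=
    ⟨Nat.find hex, Nat.find_spec hex, fun j hj => not_not.1 (Nat.find_min hex hj)⟩
  have hnk : n < k := by
    by_contra! hkn
    exact hk ⟨x, hx, (pow_dvd_pow _ hkn).trans (by rw [← neg_sub]; exact (dvd_neg.2 hTx))⟩
  obtain ⟨g, rfl⟩ := Nat.exists_eq_add_of_lt hnk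
  obtain ⟨x₁, hx₁, u, hu⟩ := hkmin (n + g) (by omega)
  obtain ⟨x₂, hx₂, v, hv, hvu⟩ := hΛ.child x₁ hx₁ (n + g) (-u)
  have hx₂T : x₂ - T = (b : ℤ) ^ (n + g) * (u + v) := by linear_combination hu + hv
  have hquv : (q : ℤ) ∣ u + v := by
    have := Int.modEq_iff_dvd.1 hvu.symm
    rwa [sub_neg_eq_add, add_comm] at this
  obtain ⟨z, hz, ⟨w, hw⟩, hzc⟩ := hD x₂ hx₂ (n + g + 1) (by omega)
  set e : ℤ := u + v + b * w with he
  have hzT : z - T = (b : ℤ) ^ (n + g) * e := by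
    rw [pow_succ] at hw
    linear_combination hw + hx₂T
  have hqe : (q : ℤ) ∣ digit b e := by
    rw [dvd_digit_iff hqb]
    exact hquv.add ((Int.natCast_dvd_natCast.2 hqb).mul_right _)
  have hbe : ¬ (b : ℤ) ∣ e := by
    rintro ⟨f, hf⟩
    exact hk ⟨z, hz, f, by rw [hzT, hf, pow_succ]; ring⟩
  have hd0 : digit b e ≠ 0 := fun h => hbe ((digit_eq_zero_iff hb e).1 h)
  have hTn : (shift b)^[n] T = 0 := by
    have h1 : T = x + (b : ℤ) ^ n * -(shift b)^[n] x := by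
      have := lowPart_add b n x
      linear_combination this
    rw [h1, iterate_shift_add_mul (by omega)]
    ring
  have hshift : (shift b)^[n + g + 1] z = shift b e := by
    have h1 : z = T + (b : ℤ) ^ (n + g) * e := by linear_combination hzT
    rw [Function.iterate_succ_apply', h1, iterate_shift_add_mul (by omega), add_comm n g,
      Function.iterate_add_apply, hTn, iterate_shift_zero (by omega), zero_add]
  rw [hshift] at hzc
  refine ⟨z, hz, ?_, (min_le_right _ _).trans ?_⟩
  · have h1 : z - x = (z - T) + (T - x) := by ring
    rw [h1, hzT, pow_add, mul_assoc]
    exact (Dvd.intro _ rfl).add hTx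
  · set t : ℝ := (ξ + T) / (b : ℝ) ^ n with htdef
    have hzt : (ξ + z) / (b : ℝ) ^ n = t + (b : ℝ) ^ g * e := by
      have h1 : (z : ℝ) = T + (b : ℝ) ^ (n + g) * e := by
        have : z = T + (b : ℤ) ^ (n + g) * e := by linear_combination hzT
        exact_mod_cast this
      rw [h1, htdef, pow_add]
      field_simp
      ring
    have htg := abs_div_pow_le (b := b) (by omega) g ht
    have hmem := abs_add_digit_div_mem hb htg hd0 (abs_digit_le hb e)
    rw [hzt]
    refine le_trans ?_ ((hmul t ht).2 g e)
    gcongr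
    conv_rhs => rw [← digit_add_mul_shift b e, hatSq_add_digit q b (by omega) _ _ _ hqb]
    rw [maskSq_add_of_dvd q _ hqe]
    gcongr
    · exact maskSq_nonneg _ _
    · exact (hmul _ htg).1.trans (hatSq_le_maskSq q b (by omega) _)
    · exact hcost _ hzc _ hmem.1 hmem.2

lemma eventually_pow_dvd_imp_eq {b : ℕ} (hb : 2 ≤ b) (x y : ℤ) :
    ∀ᶠ n : ℕ in atTop, (b : ℤ) ^ n ∣ y - x → x = y := by
  obtain ⟨N, hN⟩ := pow_unbounded_of_one_lt |y - x|
    (by exact_mod_cast (by omega : 1 < b) : (1 : ℤ) < b)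
  filter_upwards [eventually_ge_atTop N] with n hn h
  have h1 : |y - x| < (b : ℤ) ^ n :=
    hN.trans_le (pow_le_pow_right₀ (by exact_mod_cast (by omega : 1 ≤ b)) hn)
  have := Int.eq_zero_of_abs_lt_dvd h h1
  omega

/-- The quadratic sum of the Fourier transform over `Λ` is `1`, provided that it is at most `1`. -/
lemma exists_lt_sum_hatSq {q b : ℕ} [NeZero q] (hqb : q ∣ b) (hb : 3 ≤ b) {Λ : Set ℤ}
    (hΛ : IsDigitTree q b Λ) {D : ℕ} (hD : HasCostBound q b Λ D)
    (hcl : ∀ T : ℤ, (∀ n : ℕ, ∃ x ∈ Λ, (b : ℤ) ^ n ∣ x - T) → T ∈ Λ) (ξ : ℝ)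
    (hle : ∀ F : Finset ℤ, (∀ x ∈ F, x ∈ Λ) → ∑ x ∈ F, hatSq q b (ξ + x) ≤ 1)
    {η : ℝ} (hη : η < 1) :
    ∃ F : Finset ℤ, (∀ x ∈ F, x ∈ Λ) ∧ η < ∑ x ∈ F, hatSq q b (ξ + x) := by
  classical
  obtain ⟨c, hc, hgood⟩ := exists_le_hatSq_tail hqb hb hΛ hD hcl
  set S : Set ℝ := {s | ∃ F : Finset ℤ, (∀ x ∈ F, x ∈ Λ) ∧ s = ∑ x ∈ F, hatSq q b (ξ + x)} with hS
  have hbdd : BddAbove S := ⟨1, by rintro _ ⟨F, hF, rfl⟩; exact hle F hF⟩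
  have hne : S.Nonempty := ⟨0, ∅, by simp, by simp⟩
  have key : ∀ F : Finset ℤ, (∀ x ∈ F, x ∈ Λ) →
      ∑ x ∈ F, hatSq q b (ξ + x) + c * (1 - ∑ x ∈ F, hatSq q b (ξ + x)) ≤ sSup S := by
    intro F hF
    have hlim : Tendsto (fun n : ℕ => ∑ x ∈ F, hatSq q b (ξ + x)
        + c * (1 - ∑ x ∈ F, maskProd q b n (ξ + x))) atTop
        (nhds (∑ x ∈ F, hatSq q b (ξ + x) + c * (1 - ∑ x ∈ F, hatSq q b (ξ + x)))) :=
      tendsto_const_nhds.add (tendsto_const_nhds.mul (tendsto_const_nhds.sub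
        (tendsto_finsetSum _ fun x _ => tendsto_maskProd q b (by omega) _)))
    refine le_of_tendsto hlim ?_
    have hinjF : ∀ᶠ n : ℕ in atTop, ∀ x ∈ F, ∀ y ∈ F, (b : ℤ) ^ n ∣ y - x → x = y := by
      simp only [Filter.eventually_all_finset]
      exact fun x _ y _ => eventually_pow_dvd_imp_eq (by omega) x y
    filter_upwards [hgood ξ, hinjF] with n hn hnF
    obtain ⟨R, hR, hinj, hcov, hsum⟩ := exists_level hqb (by omega) hΛ n
    have hsel : ∀ r ∈ R, ∃ z ∈ Λ, (b : ℤ) ^ n ∣ z - r ∧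
        ((∃ x ∈ F, (b : ℤ) ^ n ∣ x - r) → z ∈ F) ∧
        (z ∉ F → c ≤ hatSq q b ((ξ + z) / (b : ℝ) ^ n)) := by
      intro r hr
      by_cases h : ∃ x ∈ F, (b : ℤ) ^ n ∣ x - r
      · obtain ⟨x, hx, hxr⟩ := h
        exact ⟨x, hF x hx, hxr, fun _ => hx, fun h => absurd hx h⟩
      · obtain ⟨z, hz, hzr, hzc⟩ := hn r (hR r hr)
        exact ⟨z, hz, hzr, fun h' => absurd h' h, fun _ => hzc⟩
    choose! g hgΛ hgr hgF hgc using hsel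
    have hginj : Set.InjOn g R := by
      intro r hr s hs h
      refine hinj r hr s hs ?_
      have := (hgr r hr).sub (hgr s hs)
      rwa [h, sub_sub_sub_cancel_left] at this
    have hFsub : F ⊆ R.image g := by
      intro x hx
      obtain ⟨r, hr, hxr⟩ := hcov x (hF x hx)
      refine Finset.mem_image.2 ⟨r, hr, ?_⟩
      refine (hnF x hx _ (hgF r hr ⟨x, hx, hxr⟩) ?_).symm
      have := (hgr r hr).sub hxr
      rwa [sub_sub_sub_cancel_right] at this
    have hone : ∑ z ∈ R.image g, maskProd q b n (ξ + z) = 1 := by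
      rw [Finset.sum_image hginj, ← hsum ξ]
      exact Finset.sum_congr rfl fun r hr => maskProd_congr q b hqb (by omega) ξ (hgr r hr)
    have hmem : ∑ z ∈ R.image g, hatSq q b (ξ + z) ∈ S := by
      refine ⟨R.image g, fun x hx => ?_, rfl⟩
      obtain ⟨r, hr, rfl⟩ := Finset.mem_image.1 hx
      exact hgΛ r hr
    refine le_trans ?_ (le_csSup hbdd hmem)
    rw [← Finset.sum_sdiff hFsub] at hone ⊢
    rw [add_comm]
    gcongr
    rw [show 1 - ∑ x ∈ F, maskProd q b n (ξ + x)
      = ∑ z ∈ R.image g \ F, maskProd q b n (ξ + z) by linarith, Finset.mul_sum]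
    refine Finset.sum_le_sum fun z hz => ?_
    obtain ⟨hz1, hz2⟩ := Finset.mem_sdiff.1 hz
    obtain ⟨r, hr, rfl⟩ := Finset.mem_image.1 hz1
    rw [hatSq_eq_maskProd q b (by omega) n, mul_comm]
    exact mul_le_mul_of_nonneg_left (hgc r hr hz2) (maskProd_nonneg _ _ _ _)
  have hsup : 1 ≤ sSup S := by
    by_contra! hlt
    obtain ⟨s, ⟨F, hF, rfl⟩, hs⟩ := exists_lt_of_lt_csSup hne
      (by nlinarith : sSup S - c * (1 - sSup S) < sSup S)
    have h1 := key F hF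
    have h2 : ∑ x ∈ F, hatSq q b (ξ + x) ≤ sSup S := le_csSup hbdd ⟨F, hF, rfl⟩
    nlinarith
  obtain ⟨s, ⟨F, hF, rfl⟩, hs⟩ := exists_lt_of_lt_csSup hne (hη.trans_le hsup)
  exact ⟨F, hF, hs⟩

/-! ### Exponentials in `L²` -/

lemma inner_expLp (μ : Measure ℝ) [IsFiniteMeasure μ] (l : ℝ) (f : Lp ℂ 2 μ) :
    inner ℂ (expLp μ l) f = ∫ x, unitChar (-(l * x)) * f x ∂μ := by
  rw [L2.inner_def]
  refine integral_congr_ae ?_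
  filter_upwards [(expFun_memLp μ l).coeFn_toLp] with x hx
  rw [expLp, hx, expFun_eq, RCLike.inner_apply, conj_unitChar, mul_comm]

lemma inner_expLp_expLp (q b : ℕ) [NeZero q] (l l' : ℝ) :
    inner ℂ (expLp (cantorMeasure q b) l) (expLp (cantorMeasure q b) l') = muHat q b (l' - l) := by
  rw [inner_expLp, muHat]
  refine integral_congr_ae ?_
  filter_upwards [(expFun_memLp (cantorMeasure q b) l').coeFn_toLp] with x hx
  rw [expLp, hx, expFun_eq, ← unitChar_add]
  congr 1
  ring

lemma norm_inner_expLp_sq (q b : ℕ) [NeZero q] (l l' : ℝ) :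
    ‖inner ℂ (expLp (cantorMeasure q b) l) (expLp (cantorMeasure q b) l')‖ ^ 2
      = hatSq q b (l' - l) := by
  rw [inner_expLp_expLp]
  rfl

lemma norm_expLp (q b : ℕ) [NeZero q] (l : ℝ) : ‖expLp (cantorMeasure q b) l‖ = 1 := by
  have h : ‖expLp (cantorMeasure q b) l‖ ^ 2 = 1 := by
    rw [@norm_sq_eq_re_inner ℂ, inner_expLp_expLp, sub_self]
    simp [muHat, unitChar_zero]
  exact (pow_eq_one_iff_of_nonneg (norm_nonneg _) two_ne_zero).1 h

lemma IsOrthogonalSet.orthonormal {q b : ℕ} [NeZero q] {Λ : Set ℝ}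
    (h : IsOrthogonalSet (cantorMeasure q b) Λ) :
    Orthonormal ℂ fun l : Λ => expLp (cantorMeasure q b) (l : ℝ) :=
  ⟨fun _ => norm_expLp q b _, fun i j hij => h i i.2 j j.2 fun h' => hij (Subtype.ext h')⟩

/-- An integrable real function whose Fourier transform vanishes is zero almost everywhere. -/
lemma ae_eq_zero_of_forall_integral_unitChar (μ : Measure ℝ) [IsFiniteMeasure μ] {u : ℝ → ℝ}
    (hu : Integrable u μ) (h : ∀ l : ℝ, ∫ x, unitChar (l * x) * (u x : ℂ) ∂μ = 0) :
    u =ᵐ[μ] 0 := by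
  have hm : AEMeasurable u μ := hu.aestronglyMeasurable.aemeasurable
  have hm' : AEMeasurable (fun x => -u x) μ := hm.neg
  have h1 : IsFiniteMeasure (μ.withDensity fun x => ENNReal.ofReal (u x)) :=
    isFiniteMeasure_withDensity_ofReal hu.2
  have h2 : IsFiniteMeasure (μ.withDensity fun x => ENNReal.ofReal (-u x)) :=
    isFiniteMeasure_withDensity_ofReal hu.neg.2
  have hint : ∀ (t : ℝ) (w : ℝ → ℝ), Integrable w μ →
      Integrable (fun x : ℝ => max (w x) 0 • Complex.exp (t * x * Complex.I)) μ := by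
    intro t w hw
    refine Integrable.smul_bdd (𝕜 := ℝ) hw.pos_part 1 ?_ (ae_of_all _ fun x => ?_)
    · exact (by fun_prop : Continuous fun x : ℝ =>
        Complex.exp (t * x * Complex.I)).aestronglyMeasurable
    · rw [← Complex.ofReal_mul, Complex.norm_exp_ofReal_mul_I]
  have heq : (μ.withDensity fun x => ENNReal.ofReal (u x))
      = μ.withDensity fun x => ENNReal.ofReal (-u x) := by
    refine Measure.ext_of_charFun (funext fun t => ?_)
    rw [charFun_apply_real, charFun_apply_real,
      integral_withDensity_eq_integral_toReal_smul₀ hm.ennreal_ofReal (ae_of_all _ fun x => by simp),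
      integral_withDensity_eq_integral_toReal_smul₀ hm'.ennreal_ofReal
        (ae_of_all _ fun x => by simp), ← sub_eq_zero, ← integral_sub]
    · rw [← h (-t / (2 * Real.pi))]
      refine integral_congr_ae (ae_of_all _ fun x => ?_)
      have hexp : Complex.exp (t * x * Complex.I) = unitChar (-t / (2 * Real.pi) * x) := by
        unfold unitChar
        congr 1
        have : (Real.pi : ℂ) ≠ 0 := by exact_mod_cast Real.pi_ne_zero
        push_cast
        field_simp
      have hu' : (u x : ℂ) = ((max (u x) 0 : ℝ) : ℂ) - ((max (-u x) 0 : ℝ) : ℂ) := by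
        rw [← Complex.ofReal_sub, max_zero_sub_max_neg_zero_eq_self]
      simp only [ENNReal.toReal_ofReal', Complex.real_smul]
      rw [hexp, hu']
      ring
    · simp only [ENNReal.toReal_ofReal']
      exact hint t _ hu
    · simp only [ENNReal.toReal_ofReal']
      exact hint t _ hu.neg
  have hae := (withDensity_eq_iff_of_sigmaFinite hm.ennreal_ofReal hm'.ennreal_ofReal).1 heq
  filter_upwards [hae] with x hx
  rcases le_total (u x) 0 with h0 | h0
  · rw [ENNReal.ofReal_of_nonpos h0] at hx
    have := ENNReal.ofReal_eq_zero.1 hx.symm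
    simp only [Pi.zero_apply]
    linarith
  · rw [ENNReal.ofReal_of_nonpos (p := -u x) (by linarith)] at hx
    have := ENNReal.ofReal_eq_zero.1 hx
    simp only [Pi.zero_apply]
    linarith

/-- The exponentials are total in `L²`. -/
lemma eq_zero_of_forall_inner_expLp (μ : Measure ℝ) [IsFiniteMeasure μ] (f : Lp ℂ 2 μ)
    (h : ∀ l : ℝ, inner ℂ (expLp μ l) f = 0) : f = 0 := by
  have hc := continuous_unitChar
  have hf : Integrable f μ := (Lp.memLp f).integrable (by norm_num)
  have h0 : ∀ l : ℝ, ∫ x, unitChar (l * x) * f x ∂μ = 0 := by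
    intro l
    have := h (-l)
    rw [inner_expLp] at this
    simpa using this
  have h1 : ∀ l : ℝ, ∫ x, unitChar (l * x) * (starRingEnd ℂ) (f x) ∂μ = 0 := by
    intro l
    have := congrArg (starRingEnd ℂ) (h0 (-l))
    rw [← integral_conj] at this
    simpa [conj_unitChar] using this
  have hint : ∀ (l : ℝ) (g : ℝ → ℂ), Integrable g μ →
      Integrable (fun x => unitChar (l * x) * g x) μ := fun l g hg =>
    hg.bdd_mul (c := 1) (by fun_prop : Continuous fun x => unitChar (l * x)).aestronglyMeasurable
      (ae_of_all _ fun x => (norm_unitChar _).le)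
  have hconj : Integrable (fun x => (starRingEnd ℂ) (f x)) μ := by
    exact (Complex.conjCLE.toContinuousLinearMap.integrable_comp hf)
  have hre : (fun x => (f x).re) =ᵐ[μ] 0 := by
    refine ae_eq_zero_of_forall_integral_unitChar μ hf.re fun l => ?_
    have := integral_add (hint l _ hf) (hint l _ hconj)
    rw [h0, h1, add_zero] at this
    rw [← mul_zero (2 : ℂ)⁻¹, ← this, ← integral_const_mul]
    refine integral_congr_ae (ae_of_all _ fun x => ?_)
    simp only
    rw [← mul_add, Complex.add_conj]
    push_cast
    ring
  have him : (fun x => (f x).im) =ᵐ[μ] 0 := by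
    refine ae_eq_zero_of_forall_integral_unitChar μ hf.im fun l => ?_
    have := integral_sub (hint l _ hf) (hint l _ hconj)
    rw [h0, h1, sub_zero] at this
    rw [← mul_zero (2 * Complex.I)⁻¹, ← this, ← integral_const_mul]
    refine integral_congr_ae (ae_of_all _ fun x => ?_)
    simp only
    rw [← mul_sub, Complex.sub_conj]
    push_cast
    field_simp
  refine Lp.ext ?_
  filter_upwards [hre, him, Lp.coeFn_zero ℂ 2 μ] with x h1 h2 h3
  rw [h3]
  exact Complex.ext h1 h2

lemma inner_eq_zero_of_bessel_eq {ι E : Type*} [NormedAddCommGroup E] [InnerProductSpace ℂ E]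
    {v : ι → E} (hv : Orthonormal ℂ v) {f x : E} (hf : ∀ i, inner ℂ (v i) f = 0)
    (hx : ∀ η < ‖x‖ ^ 2, ∃ s : Finset ι, η < ∑ i ∈ s, ‖inner ℂ (v i) x‖ ^ 2) :
    inner ℂ f x = 0 := by
  by_contra hne
  have hf0 : f ≠ 0 := by
    rintro rfl
    simp at hne
  have hn : ‖f‖ ≠ 0 := norm_ne_zero_iff.2 hf0
  set e : E := ((‖f‖ : ℂ)⁻¹) • f with he
  have hw : Orthonormal ℂ (fun o : Option ι => o.elim e v) := by
    refine ⟨?_, ?_⟩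
    · rintro (_ | i)
      · simp [he, norm_smul, hn]
      · exact hv.1 i
    · rintro (_ | i) (_ | j) hij
      · exact absurd rfl hij
      · simp [he, inner_smul_left, inner_eq_zero_symm.1 (hf j)]
      · simp [he, inner_smul_right, hf i]
      · exact hv.2 fun h => hij (congrArg some h)
  have hpos : 0 < ‖inner ℂ e x‖ ^ 2 := by
    have : inner ℂ e x ≠ 0 := by
      rw [he, inner_smul_left]
      exact mul_ne_zero (by simp [hf0]) hne
    positivity
  obtain ⟨s, hs⟩ := hx (‖x‖ ^ 2 - ‖inner ℂ e x‖ ^ 2) (by linarith)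
  have hb := hw.sum_inner_products_le x (s := Finset.insertNone s)
  rw [Finset.sum_insertNone] at hb
  simp only [Option.elim] at hb
  linarith

lemma IsSpectrum.isMaximalOrthogonalSet {q b : ℕ} [NeZero q] {Λ : Set ℝ}
    (h : IsSpectrum (cantorMeasure q b) Λ) : IsMaximalOrthogonalSet (cantorMeasure q b) Λ := by
  obtain ⟨B, hB⟩ := h
  refine ⟨fun l hl l' hl' hne => ?_, fun Λ' hΛ' hsub => Set.Subset.antisymm (fun l hl => ?_) hsub⟩
  · have : inner ℂ (B ⟨l, hl⟩) (B ⟨l', hl'⟩) = 0 := B.orthonormal.2 (by simpa using hne)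
    rwa [hB, hB] at this
  · by_contra hnl
    have h0 : expLp (cantorMeasure q b) l = 0 := by
      refine B.repr.injective ?_
      rw [map_zero]
      ext i
      rw [B.repr_apply_apply, hB]
      have hne : (i : ℝ) ≠ l := fun h => hnl (h ▸ i.2)
      simpa using hΛ' i (hsub i.2) l hl hne
    have := norm_expLp q b l
    rw [h0, norm_zero] at this
    exact zero_ne_one this

/-- A maximal orthogonal set of integers with the structure of a tree and bounded costs is a
spectrum. -/
theorem IsMaximalOrthogonalSet.isSpectrum {q b : ℕ} [NeZero q] (hqb : q ∣ b) (hb : 3 ≤ b)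
    {Λ : Set ℤ} (hmax : IsMaximalOrthogonalSet (cantorMeasure q b) ((fun x : ℤ => (x : ℝ)) '' Λ))
    (hΛ : IsDigitTree q b Λ) {D : ℕ} (hD : HasCostBound q b Λ D) :
    IsSpectrum (cantorMeasure q b) ((fun x : ℤ => (x : ℝ)) '' Λ) := by
  classical
  have hzero : ∀ z : ℤ, InZeroSet q b z → muHat q b z = 0 := by
    intro z hz
    have := hatSq_intCast_eq_zero q b (by omega) hz
    simpa [hatSq] using this
  have hneg : ∀ z : ℤ, InZeroSet q b z → InZeroSet q b (-z) := by
    rintro _ ⟨k, u, rfl, hu⟩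
    exact ⟨k, -u, by ring, by rwa [dvd_neg]⟩
  have hcl : ∀ T : ℤ, (∀ n : ℕ, ∃ x ∈ Λ, (b : ℤ) ^ n ∣ x - T) → T ∈ Λ := by
    intro T hT
    have hTx : ∀ x ∈ Λ, x ≠ T → InZeroSet q b (x - T) := by
      intro x hx hne
      obtain ⟨n, hn⟩ := (eventually_pow_dvd_imp_eq (b := b) (by omega) T x).exists
      obtain ⟨y, hy, w, hw⟩ := hT (n + 1)
      have hxy : x ≠ y := by
        rintro rfl
        exact hne (hn ((pow_dvd_pow _ (by omega)).trans ⟨w, hw⟩)).symm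
      obtain ⟨k, u, hk, hu⟩ := hΛ.sub_mem x hx y hy hxy
      have hkn : k < n := by
        by_contra! h
        refine hne (hn ?_).symm
        rw [show x - T = (x - y) + (y - T) by ring, hk, hw]
        exact ((pow_dvd_pow _ h).mul_right _).add ((pow_dvd_pow _ (by omega)).mul_right _)
      obtain ⟨j, rfl⟩ := Nat.exists_eq_add_of_lt hkn
      refine ⟨k, u + (b : ℤ) ^ (j + 2) * w, ?_, ?_⟩
      · rw [show x - T = (x - y) + (y - T) by ring, hk, hw]
        ring
      · rwa [Int.dvd_add_left]
        exact ((Int.natCast_dvd_natCast.2 hqb).trans (dvd_pow_self _ (by omega))).mul_right _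
    have horth : IsOrthogonalSet (cantorMeasure q b)
        (insert (T : ℝ) ((fun x : ℤ => (x : ℝ)) '' Λ)) := by
      rintro l (rfl | hl) l' (rfl | hl') hne
      · exact absurd rfl hne
      · obtain ⟨x, hx, rfl⟩ := hl'
        rw [inner_expLp_expLp, ← Int.cast_sub]
        exact hzero _ (hTx x hx fun h => hne (by rw [h]))
      · obtain ⟨x, hx, rfl⟩ := hl
        rw [inner_expLp_expLp, ← Int.cast_sub, ← neg_sub]
        exact hzero _ (hneg _ (hTx x hx fun h => hne (by rw [h])))
      · exact hmax.1 l hl l' hl' hne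
    have hmem : (T : ℝ) ∈ (fun x : ℤ => (x : ℝ)) '' Λ := by
      rw [← hmax.2 _ horth (Set.subset_insert _ _)]
      exact Set.mem_insert _ _
    obtain ⟨x, hx, hxT⟩ := hmem
    rwa [← Int.cast_injective hxT]
  have hv := hmax.1.orthonormal
  have hv' : Orthonormal ℂ fun x : Λ => expLp (cantorMeasure q b) ((x : ℤ) : ℝ) :=
    hv.comp (fun x : Λ => ⟨((x : ℤ) : ℝ), ⟨x, x.2, rfl⟩⟩) fun x y hxy => by
      simpa [Subtype.ext_iff] using hxy
  have hsum : ∀ (ξ : ℝ) (F : Finset ℤ), (∀ x ∈ F, x ∈ Λ) → ∑ x ∈ F, hatSq q b (ξ + x)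
      = ∑ x ∈ F.subtype (· ∈ Λ), ‖inner ℂ (expLp (cantorMeasure q b) ((x : ℤ) : ℝ))
          (expLp (cantorMeasure q b) (-ξ))‖ ^ 2 := by
    intro ξ F hF
    rw [← Finset.sum_subtype_of_mem (p := (· ∈ Λ)) _ hF]
    refine Finset.sum_congr rfl fun x _ => ?_
    rw [norm_inner_expLp_sq, ← hatSq_neg]
    congr 1
    ring
  have hbot : (Submodule.span ℂ (Set.range fun l : ((fun x : ℤ => (x : ℝ)) '' Λ : Set ℝ) =>
      expLp (cantorMeasure q b) (l : ℝ)))ᗮ = ⊥ := by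
    rw [Submodule.eq_bot_iff]
    intro f hf
    refine eq_zero_of_forall_inner_expLp _ f fun l => ?_
    refine inner_eq_zero_symm.1 (inner_eq_zero_of_bessel_eq hv' (fun x => ?_) fun η hη => ?_)
    · exact (Submodule.mem_orthogonal _ _).1 hf _
        (Submodule.subset_span ⟨⟨((x : ℤ) : ℝ), ⟨x, x.2, rfl⟩⟩, rfl⟩)
    · rw [norm_expLp, one_pow] at hη
      obtain ⟨F, hF, hlt⟩ := exists_lt_sum_hatSq hqb hb hΛ hD hcl (-l) (fun F hF => by
        rw [hsum _ F hF]
        refine (hv'.sum_inner_products_le _).trans ?_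
        rw [norm_expLp, one_pow]) hη
      rw [hsum _ F hF, neg_neg] at hlt
      exact ⟨_, hlt⟩
  exact ⟨HilbertBasis.mkOfOrthogonalEqBot hv hbot, fun l => by
    rw [HilbertBasis.coe_mkOfOrthogonalEqBot]⟩

/-! ### Truncations of tree branches -/

section Trunc

variable {q : ℕ} [NeZero q]

lemma length_trunc (δ : List (Fin q)) (k : ℕ) : (trunc δ k).length = k := by
  simp [trunc]

lemma trunc_ne_nil (δ : List (Fin q)) {k : ℕ} (hk : 1 ≤ k) : trunc δ k ≠ [] := by
  intro h
  have := length_trunc δ k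
  rw [h] at this
  simp at this
  omega

lemma getElem?_trunc (δ : List (Fin q)) (k i : ℕ) :
    (trunc δ k)[i]? = if i < k then some (δ[i]?.getD 0) else none := by
  unfold trunc
  rw [List.getElem?_take]
  split_ifs with h
  · rw [List.getElem?_append]
    split_ifs with h2
    · simp [h2]
    · rw [List.getElem?_replicate, if_pos (by omega), List.getElem?_eq_none (by omega)]
      rfl
  · rfl

lemma trunc_succ (δ : List (Fin q)) (k : ℕ) : trunc δ (k + 1) = trunc δ k ++ [δ[k]?.getD 0] := by
  refine List.ext_getElem? fun i => ?_
  rw [getElem?_trunc, List.getElem?_append, length_trunc, getElem?_trunc]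
  rcases lt_trichotomy i k with h | rfl | h
  · rw [if_pos (by omega), if_pos h, if_pos h]
  · simp
  · rw [if_neg (by omega), if_neg (by omega), List.getElem?_eq_none (by simp; omega)]

lemma trunc_append_add (δ δ' : List (Fin q)) (m : ℕ) :
    trunc (δ ++ δ') (δ.length + m) = δ ++ trunc δ' m := by
  refine List.ext_getElem? fun i => ?_
  rw [getElem?_trunc, List.getElem?_append, List.getElem?_append, getElem?_trunc]
  by_cases h : i < δ.length
  · rw [if_pos (by omega), if_pos h, if_pos h, List.getElem?_eq_getElem h]
    rfl
  · rw [if_neg h, if_neg h]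
    by_cases h2 : i - δ.length < m
    · rw [if_pos (by omega), if_pos h2]
    · rw [if_neg (by omega), if_neg h2]

lemma trunc_append_of_le (δ δ' : List (Fin q)) {k : ℕ} (hk : k ≤ δ.length) :
    trunc (δ ++ δ') k = trunc δ k := by
  refine List.ext_getElem? fun i => ?_
  rw [getElem?_trunc, getElem?_trunc]
  split_ifs with h
  · rw [List.getElem?_append, if_pos (by omega)]
  · rfl

lemma trunc_trunc (δ : List (Fin q)) {k n : ℕ} (hk : k ≤ n) : trunc (trunc δ n) k = trunc δ k := by
  refine List.ext_getElem? fun i => ?_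
  rw [getElem?_trunc, getElem?_trunc, getElem?_trunc]
  split_ifs with h1 h2
  · rfl
  · omega
  · rfl

lemma trunc_length (δ : List (Fin q)) : trunc δ δ.length = δ := by
  simp [trunc]

lemma exists_trunc_append (θ : List (Fin q)) (n : ℕ) :
    ∃ θ' : List (Fin q), θ' ≠ [] ∧ ∀ m, trunc θ n ++ trunc θ' m = trunc θ (n + m) := by
  refine ⟨θ.drop n ++ [0], by simp, fun m => List.ext_getElem? fun i => ?_⟩
  rw [List.getElem?_append, length_trunc, getElem?_trunc, getElem?_trunc, getElem?_trunc]
  by_cases h : i < n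
  · rw [if_pos h, if_pos h, if_pos (by omega)]
  · rw [if_neg h]
    by_cases h2 : i - n < m
    · rw [if_pos h2, if_pos (by omega), List.getElem?_append, List.length_drop, List.getElem?_drop,
        show n + (i - n) = i by omega]
      by_cases h3 : i - n < θ.length - n
      · rw [if_pos h3]
      · rw [if_neg h3, List.getElem?_eq_none (l := θ) (by omega)]
        congr 1
        rcases Nat.eq_zero_or_pos (i - n - (θ.length - n)) with h4 | h4
        · rw [h4]
          rfl
        · rw [List.getElem?_eq_none (by simp only [List.length_singleton]; omega)]
    · rw [if_neg h2, if_neg (by omega)]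

end Trunc

/-! ### Integers with prescribed digits -/

lemma exists_forall_digit_eq {b : ℕ} (hb : 2 ≤ b) (N : ℕ) (a : ℕ → ℤ)
    (ha : ∀ n, -1 ≤ a n ∧ a n ≤ (b : ℤ) - 2) (hN : ∀ n, N ≤ n → a n = 0) :
    ∃ y : ℤ, ∀ n, digit b ((shift b)^[n] y) = a n := by
  induction N generalizing a with
  | zero =>
    refine ⟨0, fun n => ?_⟩
    rw [iterate_shift_zero hb, hN n (by omega), digit_eq_self (by norm_num) (by omega)]
  | succ N ih =>
    obtain ⟨y, hy⟩ := ih (fun n => a (n + 1)) (fun n => ha (n + 1)) fun n hn => hN _ (by omega)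
    refine ⟨a 0 + b * y, fun n => ?_⟩
    rcases n with _ | n
    · rw [Function.iterate_zero, id, digit_add_mul (by omega), digit_eq_self (ha 0).1 (ha 0).2]
    · rw [Function.iterate_succ_apply, shift_add_mul (by omega), shift_eq_zero (ha 0).1 (ha 0).2,
        zero_add, hy]

lemma tsum_digit {b : ℕ} (hb : 3 ≤ b) (y : ℤ) :
    ∑' n : ℕ, (digit b ((shift b)^[n] y) : ℝ) * (b : ℝ) ^ n = y := by
  obtain ⟨N, hN⟩ := exists_iterate_shift_eq_zero hb y
  have h0 : ∀ n, N ≤ n → digit b ((shift b)^[n] y) = 0 := fun n hn => by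
    rw [hN n hn, digit_eq_self (by norm_num) (by omega)]
  rw [tsum_eq_sum (s := Finset.range N) fun n hn => by
    rw [h0 n (by simpa using hn), Int.cast_zero, zero_mul]]
  have h : ∀ n, ∑ k ∈ Finset.range n, digit b ((shift b)^[k] y) * (b : ℤ) ^ k = lowPart b n y := by
    intro n
    induction n with
    | zero => simp [lowPart]
    | succ n ih => rw [Finset.sum_range_succ, ih, lowPart_succ, mul_comm]
  have h2 := lowPart_add b N y
  rw [hN N le_rfl, mul_zero, add_zero, ← h] at h2
  exact_mod_cast h2

lemma eventually_digit_eq_zero {b : ℕ} (hb : 3 ≤ b) (y : ℤ) :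
    ∀ᶠ n : ℕ in atTop, digit b ((shift b)^[n] y) = 0 := by
  obtain ⟨N, hN⟩ := exists_iterate_shift_eq_zero hb y
  filter_upwards [eventually_ge_atTop N] with n hn
  rw [hN n hn, digit_eq_self (by norm_num) (by omega)]

lemma inZeroSet_iff {q b : ℕ} (hqb : q ∣ b) (hb : 3 ≤ b) (z : ℤ) :
    InZeroSet q b z ↔ ∃ k : ℕ, (∀ i < k, digit b ((shift b)^[i] z) = 0) ∧
      ¬ (q : ℤ) ∣ digit b ((shift b)^[k] z) := by
  have hpow : ∀ (i : ℕ) (w : ℤ), (shift b)^[i] ((b : ℤ) ^ i * w) = w := by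
    intro i w
    have := iterate_shift_add_mul (b := b) (by omega) i 0 w
    rwa [zero_add, iterate_shift_zero (by omega), zero_add] at this
  constructor
  · rintro ⟨k, u, rfl, hu⟩
    refine ⟨k, fun i hi => ?_, ?_⟩
    · obtain ⟨j, rfl⟩ := Nat.exists_eq_add_of_lt hi
      rw [show (b : ℤ) ^ (i + j + 1) * u = (b : ℤ) ^ i * (b * ((b : ℤ) ^ j * u)) by ring, hpow,
        digit_eq_zero_iff hb]
      exact Dvd.intro _ rfl
    · rwa [hpow, dvd_digit_iff hqb]
  · rintro ⟨k, h0, hk⟩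
    obtain ⟨u, hu⟩ := dvd_sub_of_digit_eq (b := b) (n := k) (x := 0) (y := z) fun i hi => by
      rw [h0 i hi, iterate_shift_zero (by omega), digit_eq_self (by norm_num) (by omega)]
    rw [sub_zero] at hu
    refine ⟨k, u, hu, ?_⟩
    rwa [hu, hpow, dvd_digit_iff hqb] at hk

/-! ### The integers coded by a tree mapping -/

/-- The set `Λ(τ)` as a set of integers. -/
def intTreeSet {q : ℕ} [NeZero q] (b : ℕ) (τ : List (Fin q) → ℤ) : Set ℤ :=
  {x | ∃ δ : List (Fin q), δ ≠ [] ∧ ∀ n, digit b ((shift b)^[n] x) = τ (trunc δ (n + 1))}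

lemma fin_eq_of_modEq {n : ℕ} {a c : Fin n} (h : ((a : ℕ) : ℤ) ≡ ((c : ℕ) : ℤ) [ZMOD n]) :
    a = c :=
  Fin.ext ((Int.natCast_modEq_iff.1 h).eq_of_lt_of_lt a.2 c.2)

section Tree

variable {q b : ℕ} [NeZero q] {τ : List (Fin q) → ℤ}

lemma IsTreeMapping.exists_int (hτ : IsTreeMapping q b τ) (hb : 3 ≤ b) {δ : List (Fin q)}
    (hδ : IsRegular τ δ) : ∃ x : ℤ, ∀ n, digit b ((shift b)^[n] x) = τ (trunc δ (n + 1)) := by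
  obtain ⟨N, hN⟩ := eventually_atTop.1 hδ
  exact exists_forall_digit_eq (by omega) N (fun n => τ (trunc δ (n + 1)))
    (fun n => hτ.range _ (trunc_ne_nil _ (by omega))) fun n hn => hN _ (by omega)

lemma IsTreeMapping.treeSet_eq (hτ : IsTreeMapping q b τ) (hb : 3 ≤ b) :
    treeSet b τ = (fun x : ℤ => (x : ℝ)) '' intTreeSet b τ := by
  ext x
  constructor
  · rintro ⟨δ, hδ, hreg, rfl⟩
    obtain ⟨y, hy⟩ := hτ.exists_int hb hreg
    exact ⟨y, ⟨δ, hδ, hy⟩, by simp only [← hy, tsum_digit hb]⟩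
  · rintro ⟨y, ⟨δ, hδ, hy⟩, rfl⟩
    refine ⟨δ, hδ, ?_, by simp only [← hy, tsum_digit hb]⟩
    obtain ⟨N, hN⟩ := eventually_atTop.1 (eventually_digit_eq_zero hb y)
    refine eventually_atTop.2 ⟨N + 1, fun m hm => ?_⟩
    obtain ⟨n, rfl⟩ := Nat.exists_eq_add_of_le' (by omega : 1 ≤ m)
    rw [← hy, hN n (by omega)]

lemma IsTreeMapping.append_modEq (hτ : IsTreeMapping q b τ) (δ : List (Fin q)) (a : Fin q) :
    τ (δ ++ [a]) ≡ ((a : ℕ) : ℤ) [ZMOD q] := by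
  have := hτ.last (δ ++ [a]) (by simp)
  rwa [List.getLast_append_singleton] at this

lemma IsTreeMapping.trunc_eq (hτ : IsTreeMapping q b τ) {δ ε : List (Fin q)} {n : ℕ}
    (h : ∀ k < n, τ (trunc δ (k + 1)) = τ (trunc ε (k + 1))) : trunc δ n = trunc ε n := by
  induction n with
  | zero => simp [trunc]
  | succ n ih =>
    have hn := h n (by omega)
    rw [trunc_succ, trunc_succ] at hn ⊢
    rw [ih fun k hk => h k (by omega)] at hn ⊢
    have h1 := hτ.append_modEq (trunc ε n) (δ[n]?.getD 0)
    rw [hn] at h1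
    rw [fin_eq_of_modEq (h1.symm.trans (hτ.append_modEq (trunc ε n) (ε[n]?.getD 0)))]

lemma IsMaximalTreeMapping.exists_extension (hτ : IsMaximalTreeMapping q b τ) (hb : 3 ≤ b)
    {δ : List (Fin q)} (hδ : δ ≠ []) : ∃ δ' : List (Fin q), ∃ x : ℤ, x ∈ intTreeSet b τ ∧
      ∀ n, digit b ((shift b)^[n] x) = τ (trunc (δ ++ δ') (n + 1)) := by
  obtain ⟨δ', _, hreg⟩ := hτ.maximal δ hδ
  obtain ⟨x, hx⟩ := hτ.toIsTreeMapping.exists_int hb hreg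
  exact ⟨δ', x, ⟨δ ++ δ', by simp [hδ], hx⟩, hx⟩

lemma IsMaximalTreeMapping.isDigitTree (hτ : IsMaximalTreeMapping q b τ) (hqb : q ∣ b)
    (hb : 3 ≤ b) : IsDigitTree q b (intTreeSet b τ) := by
  have hq0 : (0 : ℤ) < q := by exact_mod_cast Nat.pos_of_ne_zero (NeZero.ne q)
  have hqb' : (q : ℤ) ∣ b := Int.natCast_dvd_natCast.2 hqb
  refine ⟨?_, ?_, ?_⟩
  · obtain ⟨_, x, hx, _⟩ := hτ.exists_extension hb (δ := [0]) (by simp)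
    exact ⟨x, hx⟩
  · classical
    rintro x ⟨δ, _, hx⟩ y ⟨ε, _, hy⟩ hne
    have hex : ∃ n, digit b ((shift b)^[n] x) ≠ digit b ((shift b)^[n] y) := by
      by_contra! h
      obtain ⟨n, hn⟩ := (eventually_pow_dvd_imp_eq (b := b) (by omega) y x).exists
      exact hne (hn (dvd_sub_of_digit_eq fun k _ => h k)).symm
    have hn := Nat.find_spec hex
    have hmin : ∀ k < Nat.find hex, digit b ((shift b)^[k] x) = digit b ((shift b)^[k] y) :=
      fun k hk => not_not.1 (Nat.find_min hex hk)
    set n := Nat.find hex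
    obtain ⟨u, hu⟩ := dvd_sub_of_digit_eq hmin
    refine ⟨n, u, hu, fun hqu => hn ?_⟩
    have hux : (shift b)^[n] x = (shift b)^[n] y + u := by
      rw [← iterate_shift_add_mul (by omega), ← hu]
      congr 1
      ring
    have h1 : digit b ((shift b)^[n] x) ≡ digit b ((shift b)^[n] y) [ZMOD q] := by
      refine (((digit_modEq b _).of_dvd hqb').trans ?_).trans ((digit_modEq b _).of_dvd hqb').symm
      rw [hux]
      exact Int.modEq_iff_dvd.2 (by simpa using hqu)
    have htr : trunc δ n = trunc ε n :=
      hτ.toIsTreeMapping.trunc_eq fun k hk => by rw [← hx, ← hy, hmin k hk]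
    rw [hx, hy, trunc_succ, trunc_succ, htr] at h1 ⊢
    have h2 := fin_eq_of_modEq ((hτ.toIsTreeMapping.append_modEq _ _).symm.trans
      (h1.trans (hτ.toIsTreeMapping.append_modEq _ _)))
    rw [h2]
  · rintro x ⟨δ, _, hx⟩ n j
    set c := digit b ((shift b)^[n] x) + j with hc
    have hnn := Int.emod_nonneg c hq0.ne'
    have hlt := Int.emod_lt_of_pos c hq0
    have hmod := Int.mod_modEq c q
    lift c % (q : ℤ) to ℕ using hnn with r
    have hr : r < q := by exact_mod_cast hlt
    obtain ⟨δ', y, hy, hyd⟩ := hτ.exists_extension hb (δ := trunc δ n ++ [⟨r, hr⟩]) (by simp)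
    have hlen : (trunc δ n ++ [(⟨r, hr⟩ : Fin q)]).length = n + 1 := by simp [length_trunc]
    have hpre : ∀ k < n, digit b ((shift b)^[k] y) = digit b ((shift b)^[k] x) := by
      intro k hk
      rw [hyd, hx, trunc_append_of_le _ _ (by omega),
        trunc_append_of_le _ _ (by rw [length_trunc]; omega), trunc_trunc _ (by omega)]
    obtain ⟨v, hv⟩ := dvd_sub_of_digit_eq hpre
    refine ⟨y, hy, v, hv, ?_⟩
    have hvy : v = (shift b)^[n] y - (shift b)^[n] x := by
      have : (shift b)^[n] y = (shift b)^[n] x + v := by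
        rw [← iterate_shift_add_mul (by omega), ← hv]
        congr 1
        ring
      linarith
    have hdy : digit b ((shift b)^[n] y) ≡ c [ZMOD q] := by
      have h1 : trunc (trunc δ n ++ [⟨r, hr⟩] ++ δ') (n + 1) = trunc δ n ++ [⟨r, hr⟩] := by
        rw [trunc_append_of_le _ _ (by omega)]
        conv_lhs => rw [← hlen]
        exact trunc_length _
      rw [hyd, h1]
      exact (hτ.toIsTreeMapping.append_modEq _ _).trans hmod
    have h2 := ((digit_modEq b ((shift b)^[n] y)).of_dvd hqb').symm.trans hdy
    have h3 := (digit_modEq b ((shift b)^[n] x)).of_dvd hqb'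
    rw [hvy]
    have h4 := h2.sub h3.symm
    rwa [hc, add_sub_cancel_left] at h4

/-- The distance of a branch is the cost of the integer with the corresponding digits. -/
lemma branchDist_eq_cost (hqb : q ∣ b) (hb : 3 ≤ b) {δ δ' : List (Fin q)} {y : ℤ}
    (hy : ∀ m, digit b ((shift b)^[m] y) = τ (δ ++ trunc δ' (m + 1))) :
    branchDist τ δ δ' = cost q b y := by
  classical
  have hfin : (levelSet τ δ δ').Finite := by
    obtain ⟨N, hN⟩ := eventually_atTop.1 (eventually_digit_eq_zero hb y)
    refine (Set.finite_le_nat N).subset fun m hm => ?_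
    obtain ⟨h1, h2⟩ := hm
    obtain ⟨n, rfl⟩ := Nat.exists_eq_add_of_le' h1
    rw [← hy] at h2
    by_contra hlt
    exact h2 (hN n (by simp at hlt; omega))
  have hmemL : ∀ m, m ∈ levelSet τ δ δ' ↔ ∃ j, m = j + 1 ∧ digit b ((shift b)^[j] y) ≠ 0 := by
    intro m
    constructor
    · rintro ⟨h1, h2⟩
      obtain ⟨n, rfl⟩ := Nat.exists_eq_add_of_le' h1
      exact ⟨n, rfl, by rwa [hy]⟩
    · rintro ⟨j, rfl, h⟩
      exact ⟨by omega, by rwa [← hy]⟩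
  have hprev : ∀ m, 1 ≤ m → (prevLevel τ δ δ' m < m ∧
      (prevLevel τ δ δ' m = 0 ∨ prevLevel τ δ δ' m ∈ levelSet τ δ δ')) ∧
      ∀ k ∈ levelSet τ δ δ', k < m → k ≤ prevLevel τ δ δ' m := by
    intro m hm
    have hbdd : BddAbove {k | k < m ∧ (k = 0 ∨ k ∈ levelSet τ δ δ')} := ⟨m, fun k hk => hk.1.le⟩
    exact ⟨Nat.sSup_mem (s := {k | k < m ∧ (k = 0 ∨ k ∈ levelSet τ δ δ')}) ⟨0, hm, Or.inl rfl⟩ hbdd,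
      fun k hk hkm => le_csSup hbdd ⟨hkm, Or.inr hk⟩⟩
  have hL1 : ∀ m ∈ levelSet τ δ δ', 1 ≤ m := fun m hm => hm.1
  rw [branchDist, dif_pos hfin]
  set Bf := hfin.toFinset.filter fun m => ¬ (q : ℤ) ∣ τ (δ ++ trunc δ' m) with hBf
  have hBL : ∀ m ∈ Bf, m ∈ levelSet τ δ δ' := fun m hm =>
    hfin.mem_toFinset.1 (Finset.mem_filter.1 hm).1
  set G : Finset ℕ := Bf.biUnion fun m => Finset.Ioo (prevLevel τ δ δ' m) m with hG
  have hcardG : G.card = ∑ m ∈ Bf, (m - prevLevel τ δ δ' m - 1) := by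
    rw [hG, Finset.card_biUnion]
    · simp [Nat.card_Ioo]
    · have hlt : ∀ m ∈ Bf, ∀ m' ∈ Bf, m < m' → Disjoint (Finset.Ioo (prevLevel τ δ δ' m) m)
          (Finset.Ioo (prevLevel τ δ δ' m') m') := by
        intro m hm m' hm' hmm
        have := (hprev m' (hL1 _ (hBL m' hm'))).2 m (hBL m hm) hmm
        rw [Finset.disjoint_left]
        intro i hi hi'
        rw [Finset.mem_Ioo] at hi hi'
        omega
      intro m hm m' hm' hne
      rcases lt_or_gt_of_ne hne with h | h
      · exact hlt m hm m' hm' h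
      · exact (hlt m' hm' m hm h).symm
  have hdisj : Disjoint hfin.toFinset G := by
    rw [Finset.disjoint_left]
    intro i hi hiG
    obtain ⟨m, hm, him⟩ := Finset.mem_biUnion.1 hiG
    rw [Finset.mem_Ioo] at him
    have := (hprev m (hL1 _ (hBL m hm))).2 i (hfin.mem_toFinset.1 hi) him.2
    omega
  rw [← hcardG, ← Finset.card_union_of_disjoint hdisj, cost, ← Set.encard_coe_eq_coe_finsetCard,
    ← Function.Injective.encard_image Nat.succ_injective {m : ℕ | Charged q b ((shift b)^[m] y)}]
  congr 1
  ext i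
  simp only [Finset.coe_union, Set.mem_union, Finset.mem_coe, hfin.mem_toFinset, Set.mem_image,
    Set.mem_ofPred_eq, Charged, ← digit_eq_zero_iff hb, inZeroSet_iff hqb hb,
    ← Function.iterate_add_apply]
  constructor
  · rintro (hi | hi)
    · obtain ⟨j, rfl, hj⟩ := (hmemL i).1 hi
      exact ⟨j, Or.inl hj, rfl⟩
    · obtain ⟨m, hm, him⟩ := Finset.mem_biUnion.1 hi
      rw [Finset.mem_Ioo] at him
      have hp := hprev m (hL1 _ (hBL m hm))
      refine ⟨i - 1, Or.inr ⟨m - i, fun k hk => ?_, ?_⟩, by omega⟩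
      · by_contra hne
        have := hp.2 (k + (i - 1) + 1) ((hmemL _).2 ⟨_, rfl, hne⟩) (by omega)
        omega
      · rw [hy, show m - i + (i - 1) + 1 = m by omega]
        exact (Finset.mem_filter.1 hm).2
  · rintro ⟨j, hj | ⟨k, hk0, hk⟩, rfl⟩
    · exact Or.inl ((hmemL _).2 ⟨j, rfl, hj⟩)
    · have hne : digit b ((shift b)^[k + j] y) ≠ 0 := fun h => hk (by rw [h]; exact dvd_zero _)
      have hmL : k + j + 1 ∈ levelSet τ δ δ' := (hmemL _).2 ⟨_, rfl, hne⟩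
      rcases Nat.eq_zero_or_pos k with rfl | hkpos
      · left
        rwa [zero_add] at hmL
      · right
        refine Finset.mem_biUnion.2 ⟨k + j + 1, ?_, ?_⟩
        · rw [hBf, Finset.mem_filter, hfin.mem_toFinset, ← hy]
          exact ⟨hmL, hk⟩
        · have hp := hprev (k + j + 1) (by omega)
          rw [Finset.mem_Ioo]
          refine ⟨?_, by simp only [Nat.succ_eq_add_one]; omega⟩
          by_contra! hle
          rcases hp.1.2 with h0 | hL
          · simp only [Nat.succ_eq_add_one] at hle
            omega
          · obtain ⟨i, hi, hi0⟩ := (hmemL _).1 hL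
            simp only [Nat.succ_eq_add_one] at hle
            refine hi0 ?_
            have := hk0 (i - j) (by omega)
            rwa [Nat.sub_add_cancel (by omega)] at this

lemma IsTreeMapping.exists_cost_le (hτ : IsTreeMapping q b τ) (hqb : q ∣ b) (hb : 3 ≤ b)
    (hD : treeDist τ < ⊤) {x : ℤ} (hx : x ∈ intTreeSet b τ) {n : ℕ} (hn : 1 ≤ n) :
    ∃ z ∈ intTreeSet b τ, (b : ℤ) ^ n ∣ z - x ∧ cost q b ((shift b)^[n] z) ≤ treeDist τ := by
  obtain ⟨ε, _, hxd⟩ := hx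
  have hδ := trunc_ne_nil ε hn
  have hlen := length_trunc ε n
  have hpre : ∀ k < n, trunc (trunc ε n) (k + 1) = trunc ε (k + 1) :=
    fun k hk => trunc_trunc ε (by omega)
  generalize trunc ε n = δ at hδ hlen hpre
  have h1 : minDist τ δ < treeDist τ + 1 :=
    (ENat.lt_add_one_iff hD.ne).2 (le_iSup₂ (f := fun δ (_ : δ ≠ []) => minDist τ δ) δ hδ)
  obtain ⟨δ', h2⟩ := iInf_lt_iff.1 h1
  obtain ⟨hδ', h3⟩ := iInf_lt_iff.1 h2
  have h4 := (ENat.lt_add_one_iff hD.ne).1 h3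
  have hfin : (levelSet τ δ δ').Finite := by
    by_contra hinf
    rw [branchDist, dif_neg hinf] at h4
    exact absurd (hD.trans_le h4) (lt_irrefl _)
  have hreg : IsRegular τ (δ ++ δ') := by
    obtain ⟨N, hN⟩ := hfin.bddAbove
    refine eventually_atTop.2 ⟨n + N + 1, fun m hm => ?_⟩
    obtain ⟨k, rfl⟩ := Nat.exists_eq_add_of_le (by omega : n ≤ m)
    by_contra hne
    rw [← hlen, trunc_append_add] at hne
    have := hN (show k ∈ levelSet τ δ δ' from ⟨by omega, hne⟩)
    omega
  obtain ⟨z, hz⟩ := hτ.exists_int hb hreg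
  refine ⟨z, ⟨δ ++ δ', by simp [hδ], hz⟩, dvd_sub_of_digit_eq fun k hk => ?_, ?_⟩
  · rw [hz, hxd, trunc_append_of_le _ _ (by omega), hpre k hk]
  · rw [← branchDist_eq_cost (τ := τ) (δ := δ) (δ' := δ') hqb hb]
    · exact h4
    · intro m
      rw [← Function.iterate_add_apply, hz, show m + n + 1 = δ.length + (m + 1) by omega,
        trunc_append_add]

end Tree

/-! ### Rescaling -/

lemma IsDigitTree.mul {q b : ℕ} (hqb : q ∣ b) {Λ : Set ℤ} (hΛ : IsDigitTree q b Λ)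
    {K : ℤ} (hK : IsCoprime K (b : ℤ)) : IsDigitTree q b ((fun x => K * x) '' Λ) := by
  have hKq : IsCoprime K (q : ℤ) := hK.of_isCoprime_of_dvd_right (Int.natCast_dvd_natCast.2 hqb)
  refine ⟨hΛ.nonempty.image _, ?_, ?_⟩
  · rintro _ ⟨x, hx, rfl⟩ _ ⟨y, hy, rfl⟩ hne
    obtain ⟨k, u, hk, hu⟩ := hΛ.sub_mem x hx y hy fun h => hne (by rw [h])
    refine ⟨k, K * u, ?_, fun h => hu (hKq.symm.dvd_of_dvd_mul_left h)⟩
    simp only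
    rw [← mul_sub, hk]
    ring
  · rintro _ ⟨x, hx, rfl⟩ n j
    obtain ⟨s, t, hst⟩ := hKq
    obtain ⟨y, hy, v, hv, hvj⟩ := hΛ.child x hx n (s * j)
    refine ⟨_, ⟨y, hy, rfl⟩, K * v, ?_, (hvj.mul_left K).trans ?_⟩
    · simp only
      rw [← mul_sub, hv]
      ring
    · refine Int.modEq_iff_dvd.2 ⟨t * j, ?_⟩
      linear_combination -j * hst

/-- If all carries are absorbed after `t` digits, then multiplication by `K` preserves the
existence of continuations of bounded cost. -/
lemma exists_cost_mul_le {q b : ℕ} (hb : 3 ≤ b) {K : ℤ} (hK : IsCoprime K (b : ℤ)) {t : ℕ}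
    (ht : ∀ c : ℤ, |c| ≤ |K| → (shift b)^[t] c = 0) {z : ℤ} {n : ℕ} {D : ℕ∞}
    (hz : cost q b ((shift b)^[n] z) ≤ D) :
    cost q b ((shift b)^[n] (K * z)) ≤ (t + 1 : ℕ) * (D + 1) := by
  obtain ⟨c, hc, h⟩ := exists_iterate_shift_mul hb K z n
  rw [h]
  refine (cost_mul_add_le hb hK ht _ hc).trans ?_
  gcongr

lemma rescale_intCast (K : ℤ) (Λ : Set ℤ) :
    rescale K ((fun x : ℤ => (x : ℝ)) '' Λ) = (fun x : ℤ => (x : ℝ)) '' ((fun x => K * x) '' Λ) := by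
  unfold rescale
  rw [Set.image_image, Set.image_image]
  simp only [Int.cast_mul]

theorem isSpectrum_rescale {q b : ℕ} [NeZero q] (hqb : q ∣ b) (hb : 3 ≤ b)
    {τ : List (Fin q) → ℤ} (hτ : IsMaximalTreeMapping q b τ) (hD : treeDist τ < ⊤) {K : ℤ}
    (hK : IsCoprime K (b : ℤ))
    (hmax : IsMaximalOrthogonalSet (cantorMeasure q b) (rescale K (treeSet b τ))) :
    IsSpectrum (cantorMeasure q b) (rescale K (treeSet b τ)) := by
  rw [hτ.toIsTreeMapping.treeSet_eq hb, rescale_intCast] at hmax ⊢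
  obtain ⟨s, hs⟩ : ∃ s : ℕ, |K| ≤ (b : ℤ) ^ s := by
    obtain ⟨s, hs⟩ := pow_unbounded_of_one_lt |K|
      (by exact_mod_cast (by omega : 1 < b) : (1 : ℤ) < b)
    exact ⟨s, hs.le⟩
  have ht : ∀ c : ℤ, |c| ≤ |K| → (shift b)^[s + 1] c = 0 :=
    fun c hc => iterate_shift_eq_zero hb s (hc.trans hs)
  obtain ⟨D, hD'⟩ := ENat.ne_top_iff_exists.1 hD.ne
  refine hmax.isSpectrum (D := (s + 1 + 1) * (D + 1)) hqb hb
    ((hτ.isDigitTree hqb hb).mul hqb hK) ?_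
  rintro _ ⟨x, hx, rfl⟩ n hn
  obtain ⟨z, hz, hzx, hc⟩ := hτ.toIsTreeMapping.exists_cost_le hqb hb hD hx hn
  refine ⟨K * z, ⟨z, hz, rfl⟩, ?_, ?_⟩
  · simp only
    rw [← mul_sub]
    exact hzx.mul_left K
  · have := exists_cost_mul_le hb hK ht hc
    rw [← hD'] at this
    exact_mod_cast this

theorem treeDist_rescale_le {q b : ℕ} [NeZero q] (hqb : q ∣ b) (hb : 3 ≤ b)
    {τ κ : List (Fin q) → ℤ} (hτ : IsMaximalTreeMapping q b τ) (hD : treeDist τ < ⊤) {K : ℤ}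
    (hK : IsCoprime K (b : ℤ)) (hκ : IsMaximalTreeMapping q b κ)
    (heq : treeSet b κ = rescale K (treeSet b τ)) {t : ℕ}
    (ht : ∀ c : ℤ, |c| ≤ |K| → (shift b)^[t] c = 0) :
    treeDist κ ≤ (t + 1 : ℕ) * (treeDist τ + 1) := by
  rw [hτ.toIsTreeMapping.treeSet_eq hb, hκ.toIsTreeMapping.treeSet_eq hb, rescale_intCast] at heq
  have hset : intTreeSet b κ = (fun x => K * x) '' intTreeSet b τ :=
    Set.image_injective.2 Int.cast_injective heq
  refine iSup₂_le fun ε hε => ?_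
  have hn : 1 ≤ ε.length := List.length_pos_iff.2 hε
  obtain ⟨ε', x, hx, hxd⟩ := hκ.exists_extension hb hε
  rw [hset] at hx
  obtain ⟨l, hl, rfl⟩ := hx
  obtain ⟨z, hz, hzl, hc⟩ := hτ.toIsTreeMapping.exists_cost_le hqb hb hD hl hn
  have hKz : K * z ∈ intTreeSet b κ := by
    rw [hset]
    exact ⟨z, hz, rfl⟩
  obtain ⟨θ, _, hθ⟩ := hKz
  have hθε : trunc θ ε.length = ε := by
    conv_rhs => rw [← trunc_length ε, ← trunc_append_of_le ε ε' le_rfl]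
    refine hκ.toIsTreeMapping.trunc_eq fun k hk => ?_
    rw [← hθ, ← hxd]
    refine digit_iterate_eq_of_dvd (by omega) hk ?_
    simp only
    rw [← mul_sub]
    exact hzl.mul_left K
  obtain ⟨θ', hθ', htail⟩ := exists_trunc_append θ ε.length
  rw [hθε] at htail
  refine (iInf₂_le θ' hθ').trans ?_
  rw [branchDist_eq_cost (τ := κ) (y := (shift b)^[ε.length] (K * z)) hqb hb]
  · exact exists_cost_mul_le hb hK ht hc
  · intro m
    rw [htail, ← Function.iterate_add_apply, hθ]
    congr 2
    omega

lemma abs_le_pow_floor_logb {b : ℕ} (hb : 2 ≤ b) {K : ℤ} (hK : 0 < K) :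
    |K| ≤ (b : ℤ) ^ (⌊Real.logb b K⌋₊ + 1) := by
  have hb1 : (1 : ℝ) < b := by exact_mod_cast (by omega : 1 < b)
  have hK' : (0 : ℝ) < K := by exact_mod_cast hK
  have h := (Nat.lt_floor_add_one (Real.logb b K)).le
  rw [Real.logb_le_iff_le_rpow hb1 hK'] at h
  rw [abs_of_pos hK]
  have h2 : (K : ℝ) ≤ (b : ℝ) ^ (⌊Real.logb b K⌋₊ + 1) := by
    rw [← Real.rpow_natCast]
    exact_mod_cast h
  exact_mod_cast h2

end Cantor

end

theorem mainTheorem4 (q b : ℕ) [NeZero q] (hq : 2 ≤ q) (hqb : q ∣ b) (hb : 2 ≤ b / q)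
    (τ : List (Fin q) → ℤ) (hτ : Cantor.IsMaximalTreeMapping q b τ)
    (hD : Cantor.treeDist τ < ⊤)
    (K : ℤ) (hK : IsCoprime K (b : ℤ)) :
    (Cantor.IsSpectrum (Cantor.cantorMeasure q b) (Cantor.rescale K (Cantor.treeSet b τ)) ↔
      Cantor.IsMaximalOrthogonalSet (Cantor.cantorMeasure q b)
        (Cantor.rescale K (Cantor.treeSet b τ))) ∧
    (0 < K → ∀ κ : List (Fin q) → ℤ, Cantor.IsMaximalTreeMapping q b κ →
      Cantor.treeSet b κ = Cantor.rescale K (Cantor.treeSet b τ) →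
      Cantor.treeDist κ ≤
        ((2 * ⌊Real.logb b K⌋₊ + 4 : ℕ) : ℕ∞) * (Cantor.treeDist τ + 1)) := by
  have hb3 : 3 ≤ b := by
    obtain ⟨m, rfl⟩ := hqb
    rw [Nat.mul_div_cancel_left _ (by omega)] at hb
    nlinarith
  refine ⟨⟨fun h => h.isMaximalOrthogonalSet, Cantor.isSpectrum_rescale hqb hb3 hτ hD hK⟩,
    fun hKpos κ hκ heq => ?_⟩
  refine (Cantor.treeDist_rescale_le hqb hb3 hτ hD hK hκ heq
    (t := ⌊Real.logb b K⌋₊ + 1 + 1) fun c hc => Cantor.iterate_shift_eq_zero hb3 _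
      (hc.trans (Cantor.abs_le_pow_floor_logb (by omega) hKpos))).trans ?_
  exact mul_le_mul' (Nat.cast_le.2 (by omega)) le_rfl
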